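/- Let $\mathcal L$ be the first-order language with the Boolean operations $0,1,\neg,\cap,\cup$ and unary predicates $C_n$ (for integers $n\ge 1$), $\mathrm{Fin}$, and $\mathrm{Res}(n,r)$ (for $n,r\in\mathbb Z$, $n>0$). Write $x\le y$ for $x\cap y=x$, and $x-y$ for $x\cap\neg y$. An atom is a nonzero element $a$ such that $z\le a$ implies $z=0$ or $z=a$. Write $\sharp(x)=m$ for $C_m(x)\wedge\neg C_{m+1}(x)$ (where $C_0(x)$ is read as true), and $\sharp(x)\le n$ for $\neg C_{n+1}(x)$. Let $T_2$ be the $\mathcal L$-theory with the following axioms: the axioms of Boolean algebras; there are infinitely many elements; every nonzero element has an atom below it; for each $n\ge 1$, $C_n(x)$ holds if and only if there are at least $n$ distinct atoms $\le x$; $\mathrm{Fin}$ is a proper ideal; for each $n\ge 0$, $\forall x\,(\sharp(x)\le n\Rightarrow \mathrm{Fin}(x))$; and $$\forall x\,\bigl(\neg\mathrm{Fin}(x)\Rightarrow\exists y\,(y<x\wedge\neg\mathrm{Fin}(y)\wedge\neg\mathrm{Fin}(x-y))\bigr).$$ Let $T_3$ be $T_2$ together with the following Boolean–Presburger axioms,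 for all integers $m,n,r,s$ with $n>0$: 1. $\forall x\,(\mathrm{Res}(n,r)(x)\Rightarrow \mathrm{Fin}(x))$; 2. $\forall x\,(\mathrm{Fin}(x)\wedge\sharp(x)=m\Rightarrow\mathrm{Res}(n,r)(x))$ whenever $m\ge 0$ and $m\equiv r \pmod n$; 3. $\forall x\,(\mathrm{Res}(n,r)(x)\Rightarrow\mathrm{Res}(n,s)(x))$ whenever $r\equiv s\pmod n$; 4. $\forall x\,(\mathrm{Res}(n,r)(x)\Rightarrow\neg\mathrm{Res}(n,s)(x))$ whenever $r\not\equiv s\pmod n$; 5. $\forall x\,(\mathrm{Res}(m,r)(x)\Rightarrow\mathrm{Res}(n,r)(x))$ whenever $m>0$ and $n\mid m$; 6. $\forall x\,(\mathrm{Fin}(x)\Rightarrow\bigvee_{0\le r<n}\mathrm{Res}(n,r)(x))$; 7. $\forall x\forall y\,(x\cap y=0\wedge\mathrm{Res}(n,r)(x)\wedge\mathrm{Res}(n,s)(y)\Rightarrow\mathrm{Res}(n,r+s)(x\cup y))$; 8. $\forall x\forall y\,\bigl(x\cap y=0\wedge\mathrm{Res}(n,r)(x\cup y)\Rightarrow\bigvee_{0\le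 s<n,\ 0\le t<n,\ s+t\equiv r\,(\mathrm{mod}\ n)}(\mathrm{Res}(n,s)(x)\wedge\mathrm{Res}(n,t)(y))\bigr)$. Then $T_3$ is complete (it is consistent, and for every $\mathcal L$-sentence $\varphi$ it implies $\varphi$ or $\neg\varphi$), it is decidable (there is an algorithm that determines whether a given $\mathcal L$-sentence follows from $T_3$), and it has quantifier elimination (every $\mathcal L$-formula is equivalent modulo $T_3$ to a quantifier-free $\mathcal L$-formula in the same free variables). Moreover, for every infinite set $I$, the powerset of $I$ is a model of $T_3$ when the Boolean operations are the usual ones, $C_n(x)$ means that $x$ has at least $n$ elements, $\mathrm{Fin}(x)$ means that $x$ is finite, and $\mathrm{Res}(n,r)(x)$ means that $x$ is finite with $|x|\equiv r\pmod n$. -/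

import Mathlib

open FirstOrder FirstOrder.Language

namespace BoolPresburger

/-! ### The language -/

/-- Function symbols: the Boolean operations `0, 1, ¬, ∩, ∪`. -/
inductive Func : ℕ → Type
  | bot : Func 0
  | top : Func 0
  | compl : Func 1
  | inf : Func 2
  | sup : Func 2

/-- Relation symbols, all unary: `C n` for `n ≥ 1`, `fin`, and `res n r` for `n ≥ 1`, `r ∈ ℤ`. -/
inductive Rel : ℕ → Type
  | C (n : ℕ+) : Rel 1
  | fin : Rel 1
  | res (n : ℕ+) (r : ℤ) : Rel 1

/-- The language of Boolean algebras enriched with all `C n`, `Fin`, `Res(n,r)`. -/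
def lang : FirstOrder.Language.{0, 0} := ⟨Func, Rel⟩

section Formulas

variable {α : Type} {k : ℕ}

/-- Terms over the free variables `α` and the `k` bound variables in scope. -/
abbrev Tm (α : Type) (k : ℕ) : Type := lang.Term (α ⊕ Fin k)

/-- Formulas over the free variables `α` and the `k` bound variables in scope. -/
abbrev Fm (α : Type) (k : ℕ) : Type := lang.BoundedFormula α k

/-- The term `0`. -/
def tBot : Tm α k := Term.func (L := lang) Func.bot ![]

/-- The term `1`. -/
def tTop : Tm α k := Term.func (L := lang) Func.top ![]

/-- The term `¬ t`. -/
def tCompl (t : Tm α k) : Tm α k := Term.func (L := lang) Func.compl ![t]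

/-- The term `s ∩ t`. -/
def tInf (s t : Tm α k) : Tm α k := Term.func (L := lang) Func.inf ![s, t]

/-- The term `s ∪ t`. -/
def tSup (s t : Tm α k) : Tm α k := Term.func (L := lang) Func.sup ![s, t]

/-- The bound variable with index `i`. -/
def x (i : Fin k) : Tm α k := Term.var (Sum.inr i)

/-- The formula `s ≤ t`, that is `s ∩ t = s`. -/
def fLe (s t : Tm α k) : Fm α k := tInf s t =' s

/-- The formula `s < t`. -/
def fLt (s t : Tm α k) : Fm α k := fLe s t ⊓ ∼(s =' t)

/-- The formula `C_n(t)`. -/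
def fC (n : ℕ+) (t : Tm α k) : Fm α k := BoundedFormula.rel (L := lang) (Rel.C n) ![t]

/-- The formula `Fin(t)`. -/
def fFin (t : Tm α k) : Fm α k := BoundedFormula.rel (L := lang) Rel.fin ![t]

/-- The formula `Res(n,r)(t)`. -/
def fRes (n : ℕ+) (r : ℤ) (t : Tm α k) : Fm α k :=
  BoundedFormula.rel (L := lang) (Rel.res n r) ![t]

/-- The formula `♯(t) ≤ n`, that is, `t` does not contain `n + 1` distinct atoms. -/
def fSharpLe (n : ℕ) (t : Tm α k) : Fm α k := ∼(fC n.succPNat t)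

/-- The formula `♯(t) = m`, that is `C_m(t) ∧ ¬ C_{m+1}(t)`. There is no symbol `C_0`, whose
meaning would be trivially true, so that `♯(t) = 0` is `¬ C_1(t)`. -/
def fSharpEq : ℕ → Tm α k → Fm α k
  | 0, t => ∼(fC 1 t)
  | m + 1, t => fC m.succPNat t ⊓ ∼(fC (m + 1).succPNat t)

/-- The bound variable with index `i` is an atom: it is nonzero and every `z ≤ x i` is `0` or
`x i`. -/
def fAtom (i : Fin k) : Fm α k :=
  ∼(x i =' tBot) ⊓
    ∀' (fLe (x (Fin.last k)) (x i.castSucc) ⟹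
      ((x (Fin.last k) =' tBot) ⊔ (x (Fin.last k) =' x i.castSucc)))

/-- `n`-fold existential quantification, of the variables with indices `k, …, k + n - 1`. -/
def exN : ∀ n : ℕ, Fm α (k + n) → Fm α k
  | 0, φ => φ
  | n + 1, φ => exN n (BoundedFormula.ex φ)

end Formulas

/-- There are `n` distinct atoms `≤ x 0`. -/
noncomputable def fAtLeastAtoms (n : ℕ) : Fm Empty 1 :=
  exN n
    ((BoundedFormula.iInf fun i : Fin n =>
        fAtom (Fin.natAdd 1 i) ⊓ fLe (x (Fin.natAdd 1 i)) (x (Fin.castAdd n 0))) ⊓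
      BoundedFormula.iInf fun p : {p : Fin n × Fin n // p.1 ≠ p.2} =>
        ∼(x (Fin.natAdd 1 p.1.1) =' x (Fin.natAdd 1 p.1.2)))

/-! ### The axioms -/

/-- The axioms of Boolean algebras. -/
def booleanAxioms : lang.Theory :=
  { ∀' ∀' (tInf (x 0) (x 1) =' tInf (x 1) (x 0)),
    ∀' ∀' (tSup (x 0) (x 1) =' tSup (x 1) (x 0)),
    ∀' ∀' ∀' (tInf (tInf (x 0) (x 1)) (x 2) =' tInf (x 0) (tInf (x 1) (x 2))),
    ∀' ∀' ∀' (tSup (tSup (x 0) (x 1)) (x 2) =' tSup (x 0) (tSup (x 1) (x 2))),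
    ∀' ∀' (tInf (x 0) (tSup (x 0) (x 1)) =' x 0),
    ∀' ∀' (tSup (x 0) (tInf (x 0) (x 1)) =' x 0),
    ∀' ∀' ∀' (tInf (x 0) (tSup (x 1) (x 2)) =' tSup (tInf (x 0) (x 1)) (tInf (x 0) (x 2))),
    ∀' ∀' ∀' (tSup (x 0) (tInf (x 1) (x 2)) =' tInf (tSup (x 0) (x 1)) (tSup (x 0) (x 2))),
    ∀' (tSup (x 0) tBot =' x 0),
    ∀' (tInf (x 0) tTop =' x 0),
    ∀' (tInf (x 0) (tCompl (x 0)) =' tBot),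
    ∀' (tSup (x 0) (tCompl (x 0)) =' tTop) }

/-- Every nonzero element has an atom below it. -/
def atomicAxiom : lang.Sentence :=
  ∀' (∼(x 0 =' tBot) ⟹ ∃' (fAtom 1 ⊓ fLe (x 1) (x 0)))

/-- `C_n(x)` holds iff there are at least `n` distinct atoms below `x`. -/
noncomputable def cAxiom (n : ℕ+) : lang.Sentence :=
  ∀' (fC n (x 0) ⇔ fAtLeastAtoms n)

/-- Infinite atomic Boolean algebras, with the `C_n` as intended. -/
noncomputable def T₁ : lang.Theory :=
  booleanAxioms ∪ lang.infiniteTheory ∪ {atomicAxiom} ∪ Set.range cAxiom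

/-- `Fin` is a proper ideal. -/
def properIdealAxioms : lang.Theory :=
  { fFin tBot,
    ∀' ∀' (fFin (x 0) ⊓ fLe (x 1) (x 0) ⟹ fFin (x 1)),
    ∀' ∀' (fFin (x 0) ⊓ fFin (x 1) ⟹ fFin (tSup (x 0) (x 1))),
    ∼(fFin tTop) }

/-- `♯(x) ≤ n` implies `Fin(x)`. -/
def smallAxiom (n : ℕ) : lang.Sentence :=
  ∀' (fSharpLe n (x 0) ⟹ fFin (x 0))

/-- If `¬ Fin(x)`, there is `y < x` with `¬ Fin(y)` and `¬ Fin(x - y)`. -/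
def mainAxiom : lang.Sentence :=
  ∀' (∼(fFin (x 0)) ⟹
    ∃' (fLt (x 1) (x 0) ⊓ ∼(fFin (x 1)) ⊓ ∼(fFin (tInf (x 0) (tCompl (x 1))))))

/-- Infinite atomic Boolean algebras with a proper ideal `Fin` that contains all `x` with `♯(x)`
finite and satisfies the splitting axiom for elements outside it. -/
noncomputable def T₂ : lang.Theory :=
  T₁ ∪ properIdealAxioms ∪ Set.range smallAxiom ∪ {mainAxiom}

/-- The Boolean–Presburger axioms. -/
inductive IsBooleanPresburgerAxiom : lang.Sentence → Prop
  | fin (n : ℕ+) (r : ℤ) :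
      IsBooleanPresburgerAxiom (∀' (fRes n r (x 0) ⟹ fFin (x 0)))
  | card (n : ℕ+) (r : ℤ) (m : ℕ) (h : (m : ℤ) ≡ r [ZMOD (n : ℤ)]) :
      IsBooleanPresburgerAxiom (∀' (fFin (x 0) ⊓ fSharpEq m (x 0) ⟹ fRes n r (x 0)))
  | congr (n : ℕ+) (r s : ℤ) (h : r ≡ s [ZMOD (n : ℤ)]) :
      IsBooleanPresburgerAxiom (∀' (fRes n r (x 0) ⟹ fRes n s (x 0)))
  | incongr (n : ℕ+) (r s : ℤ) (h : ¬ r ≡ s [ZMOD (n : ℤ)]) :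
      IsBooleanPresburgerAxiom (∀' (fRes n r (x 0) ⟹ ∼(fRes n s (x 0))))
  | dvd (n m : ℕ+) (r : ℤ) (h : (n : ℕ) ∣ m) :
      IsBooleanPresburgerAxiom (∀' (fRes m r (x 0) ⟹ fRes n r (x 0)))
  | exists_res (n : ℕ+) :
      IsBooleanPresburgerAxiom
        (∀' (fFin (x 0) ⟹ BoundedFormula.iSup fun r : Fin n => fRes n (r : ℕ) (x 0)))
  | add (n : ℕ+) (r s : ℤ) :
      IsBooleanPresburgerAxiom
        (∀' ∀' ((tInf (x 0) (x 1) =' tBot) ⊓ fRes n r (x 0) ⊓ fRes n s (x 1) ⟹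
          fRes n (r + s) (tSup (x 0) (x 1))))
  | split (n : ℕ+) (r : ℤ) :
      IsBooleanPresburgerAxiom
        (∀' ∀' ((tInf (x 0) (x 1) =' tBot) ⊓ fRes n r (tSup (x 0) (x 1)) ⟹
          BoundedFormula.iSup
            fun p : {p : Fin n × Fin n // ((p.1 : ℕ) : ℤ) + ((p.2 : ℕ) : ℤ) ≡ r [ZMOD (n : ℤ)]} =>
              fRes n (p.1.1 : ℕ) (x 0) ⊓ fRes n (p.1.2 : ℕ) (x 1)))

/-- `T₂` together with the Boolean–Presburger axioms. -/
noncomputable def T₃ : lang.Theory :=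
  T₂ ∪ {φ | IsBooleanPresburgerAxiom φ}

/-! ### The intended models -/

/-- The interpretation of the relation symbols in the powerset of `I`. -/
def powersetRel {I : Type*} : ∀ {n : ℕ}, Rel n → (Fin n → Set I) → Prop
  | _, .C n, a => ((n : ℕ) : ℕ∞) ≤ (a 0).encard
  | _, .fin, a => (a 0).Finite
  | _, .res n r, a => (a 0).Finite ∧ ((a 0).ncard : ℤ) ≡ r [ZMOD (n : ℤ)]

/-- The interpretation of the function symbols in the powerset of `I`. -/
def powersetFun {I : Type*} : ∀ {n : ℕ}, Func n → (Fin n → Set I) → Set I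
  | _, .bot, _ => ∅
  | _, .top, _ => Set.univ
  | _, .compl, a => (a 0)ᶜ
  | _, .inf, a => a 0 ∩ a 1
  | _, .sup, a => a 0 ∪ a 1

/-- The powerset of `I` with the intended interpretation of all symbols. -/
instance powersetStructure (I : Type*) : lang.Structure (Set I) where
  funMap := powersetFun
  RelMap := powersetRel

/-! ### Quantifier elimination and decidability -/

/-- Every formula is equivalent modulo `T` to a quantifier-free formula in the same free
variables. -/
def HasQE {L : FirstOrder.Language.{0, 0}} (T : L.Theory) : Prop :=
  ∀ (α : Type) (φ : L.Formula α), ∃ ψ : L.Formula α, ψ.IsQF ∧ T.Iff φ ψ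

/-- Gödel numbers of terms without free variables. -/
def termCode {k : ℕ} : Tm Empty k → ℕ
  | .var (.inl e) => e.elim
  | .var (.inr i) => Nat.pair 0 i
  | .func (l := 0) Func.bot _ => Nat.pair 1 0
  | .func (l := 0) Func.top _ => Nat.pair 2 0
  | .func (l := 1) Func.compl ts => Nat.pair 3 (termCode (ts 0))
  | .func (l := 2) Func.inf ts => Nat.pair 4 (Nat.pair (termCode (ts 0)) (termCode (ts 1)))
  | .func (l := 2) Func.sup ts => Nat.pair 5 (Nat.pair (termCode (ts 0)) (termCode (ts 1)))

/-- Gödel numbers of formulas without free variables, with `k` bound variables in scope. -/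
def formulaCode : ∀ {k : ℕ}, Fm Empty k → ℕ
  | _, .falsum => Nat.pair 0 0
  | _, .equal s t => Nat.pair 1 (Nat.pair (termCode s) (termCode t))
  | _, .rel (l := 1) (Rel.C n) ts => Nat.pair 2 (Nat.pair n (termCode (ts 0)))
  | _, .rel (l := 1) Rel.fin ts => Nat.pair 3 (termCode (ts 0))
  | _, .rel (l := 1) (Rel.res n r) ts =>
      Nat.pair 4 (Nat.pair n (Nat.pair (Equiv.intEquivNat r) (termCode (ts 0))))
  | _, .imp φ ψ => Nat.pair 5 (Nat.pair (formulaCode φ) (formulaCode ψ))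
  | _, .all φ => Nat.pair 6 (formulaCode φ)

theorem termCode_injective {k : ℕ} : Function.Injective (termCode (k := k)) := by
  intro s
  induction s with
  | var a =>
    intro t h
    rcases a with a | i
    · exact a.elim
    · cases t with
      | var b =>
        rcases b with b | j
        · exact b.elim
        · simp [termCode] at h; rw [Fin.ext h]
      | func g us => cases g <;> simp [termCode] at h
  | func f ts ih =>
    intro t h
    cases t with
    | var b =>
        rcases b with b | j
        · exact b.elim
        · cases f <;> simp [termCode] at h
    | func g us =>
      cases f <;> cases g <;> simp [termCode] at h
      · congr; exact Subsingleton.elim _ _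
      · congr; exact Subsingleton.elim _ _
      · congr; funext i; fin_cases i; exact ih 0 h
      · congr; funext i; fin_cases i; exacts [ih 0 h.1, ih 1 h.2]
      · congr; funext i; fin_cases i; exacts [ih 0 h.1, ih 1 h.2]

theorem formulaCode_injective {k : ℕ} : Function.Injective (formulaCode (k := k)) := by
  intro φ
  induction φ with
  | falsum =>
    intro ψ h
    cases ψ with
    | rel R us => cases R <;> simp [formulaCode] at h
    | _ => simp_all [formulaCode]
  | equal s t =>
    intro ψ h
    cases ψ with
    | rel R us => cases R <;> simp [formulaCode] at h
    | equal s' t' =>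
      simp [formulaCode] at h
      rw [termCode_injective h.1, termCode_injective h.2]
    | _ => simp [formulaCode] at h
  | rel R ts =>
    intro ψ h
    cases ψ with
    | rel S us =>
      cases R <;> cases S <;> simp [formulaCode] at h
      · obtain ⟨rfl, h⟩ := h
        congr; funext i; fin_cases i; exact termCode_injective h
      · congr; funext i; fin_cases i; exact termCode_injective h
      · obtain ⟨rfl, rfl, h⟩ := h
        congr; funext i; fin_cases i; exact termCode_injective h
    | _ => cases R <;> simp [formulaCode] at h
  | imp a b iha ihb =>
    intro ψ h
    cases ψ with
    | rel S us => cases S <;> simp [formulaCode] at h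
    | imp c d => simp [formulaCode] at h; rw [iha h.1, ihb h.2]
    | _ => simp [formulaCode] at h
  | all a ih =>
    intro ψ h
    cases ψ with
    | rel S us => cases S <;> simp [formulaCode] at h
    | all c => simp [formulaCode] at h; rw [ih h]
    | _ => simp [formulaCode] at h

/-- `T` is decidable: the set of Gödel numbers of the sentences that follow from `T` is
computable. -/
def IsDecidable (T : lang.Theory) : Prop :=
  ComputablePred fun n : ℕ => ∃ φ : lang.Sentence, formulaCode φ = n ∧ T ⊨ᵇ φ

end BoolPresburger

namespace BoolPresburger

/-! A model of `T₃` is an infinite atomic Boolean algebra `B` with an ideal of "pseudofinite"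
elements (which may have infinitely many atoms), each with a residue modulo every `n`. All that a
formula can see of a single element is a truncated number of atoms, membership in `Fin` and one
residue modulo some `M`; `Similar N M` says that two elements, possibly of different models, agree
on these data up to `N`.

The heart of the proof is `Similar.exists_split`: if two elements are similar at level `2 * N + M`,
each way to cut the first in two is matched, up to similarity at level `N`, by a way to cut the
second. A tuple is treated through its minterms, which are pairwise disjoint and have every Boolean
combination of the tuple as a join. Cutting all minterms at once gives a back-and-forth step for
tuples (`TupleSimilar.exists_snoc`), and induction on formulas shows that tuples with similar
minterms satisfy the same formulas of bounded `rank` (`TupleSimilar.realize_iff`).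

Completeness follows because the only minterm of the empty tuple is `⊤`, which is outside `Fin` in
every model; the powersets of infinite sets are models. Quantifier elimination follows because
similarity of minterms is expressed by finitely many quantifier-free formulas, so a formula is a
Boolean combination of these.

By completeness, decidability reduces to deciding truth in the powerset of `ℕ`. There a tuple is
represented by the cardinalities of its cells. A quantifier need only run over finitely many ways to
cut the cells, since a finite part of an infinite cell may be replaced by a similar one of bounded
size. The resulting evaluation of Gödel numbers is primitive recursive by course-of-values
recursion. -/

/-- The number of atoms below an element of a Boolean algebra. -/
noncomputable def atomCount {B : Type*} [BooleanAlgebra B] (b : B) : ℕ∞ :=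
  {a : B | IsAtom a ∧ a ≤ b}.encard

/-! ### Structures for the language, read as Boolean algebras. -/

section Predicates

variable {B : Type*} [lang.Structure B]

/-- The interpretation of `Fin`. -/
def IsFin (b : B) : Prop := Structure.RelMap (L := lang) Rel.fin ![b]

/-- The interpretation of `Res(n,r)`. -/
def HasRes (n : ℕ+) (r : ℤ) (b : B) : Prop := Structure.RelMap (L := lang) (Rel.res n r) ![b]

/-- The interpretation of `C_n`. -/
def HasC (n : ℕ+) (b : B) : Prop := Structure.RelMap (L := lang) (Rel.C n) ![b]

end Predicates

/-- The function symbols are interpreted by the operations of the Boolean algebra. -/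
structure OpsAgree (B : Type*) [BooleanAlgebra B] [lang.Structure B] : Prop where
  bot (a : Fin 0 → B) : Structure.funMap (L := lang) Func.bot a = ⊥
  top (a : Fin 0 → B) : Structure.funMap (L := lang) Func.top a = ⊤
  compl (a : Fin 1 → B) : Structure.funMap (L := lang) Func.compl a = (a 0)ᶜ
  inf (a : Fin 2 → B) : Structure.funMap (L := lang) Func.inf a = a 0 ⊓ a 1
  sup (a : Fin 2 → B) : Structure.funMap (L := lang) Func.sup a = a 0 ⊔ a 1

/-- The semantic content of `T₃` for a structure whose operations form a Boolean algebra. -/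
structure IsPresburgerAlgebra (B : Type*) [BooleanAlgebra B] [lang.Structure B] : Prop
    extends OpsAgree B where
  infinite : Infinite B
  exists_atom (b : B) : b ≠ ⊥ → ∃ a, IsAtom a ∧ a ≤ b
  hasC_iff (n : ℕ+) (b : B) : HasC n b ↔ ((n : ℕ) : ℕ∞) ≤ atomCount b
  fin_bot : IsFin (⊥ : B)
  fin_mono (a b : B) : IsFin a → b ≤ a → IsFin b
  fin_sup (a b : B) : IsFin a → IsFin b → IsFin (a ⊔ b)
  not_fin_top : ¬ IsFin (⊤ : B)
  fin_of_atomCount_le (n : ℕ) (b : B) : atomCount b ≤ n → IsFin b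
  exists_split (b : B) : ¬ IsFin b → ∃ c, c < b ∧ ¬ IsFin c ∧ ¬ IsFin (b ⊓ cᶜ)
  fin_of_res (n : ℕ+) (r : ℤ) (b : B) : HasRes n r b → IsFin b
  res_of_atomCount (n : ℕ+) (m : ℕ) (b : B) : IsFin b → atomCount b = m → HasRes n m b
  res_congr (n : ℕ+) (r s : ℤ) (b : B) : r ≡ s [ZMOD (n : ℤ)] → HasRes n r b → HasRes n s b
  res_unique (n : ℕ+) (r s : ℤ) (b : B) : HasRes n r b → HasRes n s b → r ≡ s [ZMOD (n : ℤ)]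
  res_dvd (n m : ℕ+) (r : ℤ) (b : B) : (n : ℕ) ∣ m → HasRes m r b → HasRes n r b
  exists_res (n : ℕ+) (b : B) : IsFin b → ∃ r : ℕ, r < n ∧ HasRes n r b
  res_sup (n : ℕ+) (r s : ℤ) (a b : B) :
    a ⊓ b = ⊥ → HasRes n r a → HasRes n s b → HasRes n (r + s) (a ⊔ b)
  res_split (n : ℕ+) (r : ℤ) (a b : B) : a ⊓ b = ⊥ → HasRes n r (a ⊔ b) →
    ∃ s t : ℕ, s < n ∧ t < n ∧ (s : ℤ) + t ≡ r [ZMOD (n : ℤ)] ∧ HasRes n s a ∧ HasRes n t b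

/-! ### The meaning of the formulas that occur in the axioms. -/

section Realize

variable {B : Type*} [lang.Structure B] {α : Type} {k : ℕ} {v : α → B} {xs : Fin k → B}

@[simp]
theorem realize_x (i : Fin k) : (x i : Tm α k).realize (Sum.elim v xs) = xs i := rfl

@[simp]
theorem realize_fC (n : ℕ+) (t : Tm α k) :
    (fC n t).Realize v xs ↔ HasC n (t.realize (Sum.elim v xs)) :=
  iff_of_eq (congrArg (Structure.RelMap (L := lang) (Rel.C n))
    (funext fun i => by fin_cases i; rfl))

@[simp]
theorem realize_fFin (t : Tm α k) :
    (fFin t).Realize v xs ↔ IsFin (t.realize (Sum.elim v xs)) :=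
  iff_of_eq (congrArg (Structure.RelMap (L := lang) (Rel.fin))
    (funext fun i => by fin_cases i; rfl))

@[simp]
theorem realize_fRes (n : ℕ+) (r : ℤ) (t : Tm α k) :
    (fRes n r t).Realize v xs ↔ HasRes n r (t.realize (Sum.elim v xs)) :=
  iff_of_eq (congrArg (Structure.RelMap (L := lang) (Rel.res n r))
    (funext fun i => by fin_cases i; rfl))

theorem realize_exN {n : ℕ} {φ : Fm α (k + n)} :
    (exN n φ).Realize v xs ↔ ∃ ys : Fin n → B, φ.Realize v (Fin.append xs ys) := by
  induction n with
  | zero =>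
    refine ⟨fun h => ⟨Fin.elim0, by rw [Fin.append_elim0]; exact h⟩, fun ⟨ys, h⟩ => ?_⟩
    rw [Subsingleton.elim ys Fin.elim0] at h
    rw [Fin.append_elim0] at h
    exact h
  | succ n ih =>
    rw [exN, ih]
    simp only [BoundedFormula.realize_ex]
    constructor
    · rintro ⟨ys, y, h⟩
      exact ⟨Fin.snoc ys y, by rwa [Fin.append_snoc]⟩
    · rintro ⟨ys, h⟩
      refine ⟨Fin.init ys, ys (Fin.last n), ?_⟩
      rwa [← Fin.append_snoc, Fin.snoc_init_self]

/-- Only `hC` is assumed, and not `IsPresburgerAlgebra`, because the equivalence also serves to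
derive the latter from the axioms. -/
theorem realize_fSharpLe [BooleanAlgebra B]
    (hC : ∀ (n : ℕ+) (b : B), HasC n b ↔ ((n : ℕ) : ℕ∞) ≤ atomCount b)
    (n : ℕ) (t : Tm α k) :
    (fSharpLe n t).Realize v xs ↔ atomCount (t.realize (Sum.elim v xs)) ≤ n := by
  simp only [fSharpLe, BoundedFormula.realize_not, realize_fC, hC, Nat.succPNat_coe, not_le]
  rw [Nat.succ_eq_add_one, Nat.cast_add, Nat.cast_one, ENat.lt_add_one_iff (ENat.natCast_ne_top n)]

theorem realize_fSharpEq [BooleanAlgebra B]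
    (hC : ∀ (n : ℕ+) (b : B), HasC n b ↔ ((n : ℕ) : ℕ∞) ≤ atomCount b)
    (n : ℕ) (t : Tm α k) :
    (fSharpEq n t).Realize v xs ↔ atomCount (t.realize (Sum.elim v xs)) = n := by
  cases n with
  | zero =>
    simp only [fSharpEq, BoundedFormula.realize_not, realize_fC, hC, PNat.one_coe, Nat.cast_one,
      not_le, Order.lt_one_iff, Nat.cast_zero]
  | succ n =>
    simp only [fSharpEq, BoundedFormula.realize_inf, BoundedFormula.realize_not, realize_fC, hC,
      Nat.succPNat_coe, not_le]
    rw [Nat.succ_eq_add_one, Nat.succ_eq_add_one, Nat.cast_add (n + 1), Nat.cast_one,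
      ENat.lt_add_one_iff (ENat.natCast_ne_top _), le_antisymm_iff, and_comm]

variable [BooleanAlgebra B] (H : OpsAgree B)
include H

theorem realize_tBot : (tBot : Tm α k).realize (Sum.elim v xs) = ⊥ := H.bot _

theorem realize_tTop : (tTop : Tm α k).realize (Sum.elim v xs) = ⊤ := H.top _

theorem realize_tCompl (t : Tm α k) :
    (tCompl t).realize (Sum.elim v xs) = (t.realize (Sum.elim v xs))ᶜ := H.compl _

theorem realize_tInf (s t : Tm α k) : (tInf s t).realize (Sum.elim v xs) =
    s.realize (Sum.elim v xs) ⊓ t.realize (Sum.elim v xs) := H.inf _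

theorem realize_tSup (s t : Tm α k) : (tSup s t).realize (Sum.elim v xs) =
    s.realize (Sum.elim v xs) ⊔ t.realize (Sum.elim v xs) := H.sup _

theorem realize_fLe (s t : Tm α k) : (fLe s t).Realize v xs ↔
    s.realize (Sum.elim v xs) ≤ t.realize (Sum.elim v xs) := by
  rw [fLe, BoundedFormula.realize_bdEqual, realize_tInf H, inf_eq_left]

theorem realize_fLt (s t : Tm α k) : (fLt s t).Realize v xs ↔
    s.realize (Sum.elim v xs) < t.realize (Sum.elim v xs) := by
  rw [fLt, BoundedFormula.realize_inf, realize_fLe H, BoundedFormula.realize_not,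
    BoundedFormula.realize_bdEqual, lt_iff_le_and_ne]

theorem realize_fAtom (i : Fin k) : (fAtom i : Fm α k).Realize v xs ↔ IsAtom (xs i) := by
  simp only [fAtom, BoundedFormula.realize_inf, BoundedFormula.realize_not,
    BoundedFormula.realize_bdEqual, realize_tBot H, realize_x, BoundedFormula.realize_all,
    BoundedFormula.realize_imp, realize_fLe H, BoundedFormula.realize_sup, Fin.snoc_last,
    Fin.snoc_castSucc, IsAtom]
  refine and_congr_right fun h0 => forall_congr' fun b => ?_
  constructor
  · intro h hb
    exact (h hb.le).resolve_right hb.ne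
  · intro h hb
    rcases hb.eq_or_lt with h1 | h1
    · exact .inr h1
    · exact .inl (h h1)

theorem realize_fAtLeastAtoms (n : ℕ) (v : Empty → B) (xs : Fin 1 → B) :
    (fAtLeastAtoms n).Realize v xs ↔ (n : ℕ∞) ≤ atomCount (xs 0) := by
  simp only [fAtLeastAtoms, realize_exN, BoundedFormula.realize_inf, BoundedFormula.realize_iInf,
    realize_fAtom H, realize_fLe H, realize_x, Fin.append_right, Fin.append_left,
    BoundedFormula.realize_not, BoundedFormula.realize_bdEqual, Subtype.forall, Prod.forall]
  constructor
  · rintro ⟨ys, h1, h2⟩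
    have hinj : Function.Injective ys := fun i j hij => by
      by_contra hne
      exact h2 i j hne hij
    have : (Set.range ys).encard = n := by
      rw [← Set.image_univ, hinj.encard_image, Set.encard_univ]; simp
    rw [← this]
    exact Set.encard_le_encard (by rintro _ ⟨i, rfl⟩; exact h1 i)
  · intro h
    obtain ⟨t, ht, hn⟩ := Set.exists_subset_encard_eq h
    have hfin : t.Finite := Set.finite_of_encard_eq_coe hn
    have hc : Nat.card t = n := by
      rw [Nat.card_coe_set_eq, Set.ncard, hn]; rfl
    have := hfin.to_subtype
    let e := (Finite.equivFinOfCardEq hc).symm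
    exact ⟨fun i => (e i : B), fun i => ht (e i).2,
      fun i j hij h => hij (e.injective (Subtype.ext h))⟩

end Realize

/-! ### Models of `T₃` are the Presburger algebras; powersets as examples. -/

section Models

theorem realize_sentence_all {B : Type*} [lang.Structure B] {φ : Fm Empty 1} :
    B ⊨ (∀' φ : lang.Sentence) ↔ ∀ b : B, φ.Realize default ![b] := by
  refine forall_congr' fun b => ?_
  have : Fin.snoc default b = ![b] := by funext i; fin_cases i; rfl
  rw [← this]

theorem realize_sentence_all₂ {B : Type*} [lang.Structure B] {φ : Fm Empty 2} :
    B ⊨ (∀' ∀' φ : lang.Sentence) ↔ ∀ a b : B, φ.Realize default ![a, b] := by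
  refine forall_congr' fun a => forall_congr' fun b => ?_
  have : Fin.snoc (Fin.snoc default a : Fin 1 → B) b = ![a, b] := by
    funext i; fin_cases i <;> rfl
  rw [← this]

theorem realize_sentence_all₃ {B : Type*} [lang.Structure B] {φ : Fm Empty 3} :
    B ⊨ (∀' ∀' ∀' φ : lang.Sentence) ↔ ∀ a b c : B, φ.Realize default ![a, b, c] := by
  refine forall_congr' fun a => forall_congr' fun b => forall_congr' fun c => ?_
  have : Fin.snoc (Fin.snoc (Fin.snoc default a : Fin 1 → B) b : Fin 2 → B) c = ![a, b, c] := by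
    funext i; fin_cases i <;> rfl
  rw [← this]

theorem snoc_vec_one {B : Type*} (a b : B) : (Fin.snoc ![a] b : Fin 2 → B) = ![a, b] := by
  funext i; fin_cases i <;> rfl

variable {B : Type*} [lang.Structure B]

theorem model_T₃_iff : B ⊨ T₃ ↔ B ⊨ booleanAxioms ∧ Infinite B ∧ B ⊨ atomicAxiom ∧
    (∀ n, B ⊨ cAxiom n) ∧ B ⊨ properIdealAxioms ∧ (∀ n, B ⊨ smallAxiom n) ∧ B ⊨ mainAxiom ∧
    ∀ φ, IsBooleanPresburgerAxiom φ → B ⊨ φ := by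
  simp only [T₃, T₂, T₁, Theory.model_union_iff, Theory.model_singleton_iff,
    model_infiniteTheory_iff, and_assoc]
  simp only [Theory.model_iff, Set.forall_mem_range, Set.mem_ofPred_eq]

section RawOperations

variable (B) in
/-- The interpretation of `0`. -/
def opBot : B := Structure.funMap (L := lang) Func.bot ![]

variable (B) in
/-- The interpretation of `1`. -/
def opTop : B := Structure.funMap (L := lang) Func.top ![]

/-- The interpretation of `¬`. -/
def opCompl (a : B) : B := Structure.funMap (L := lang) Func.compl ![a]

/-- The interpretation of `∩`. -/
def opInf (a b : B) : B := Structure.funMap (L := lang) Func.inf ![a, b]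

/-- The interpretation of `∪`. -/
def opSup (a b : B) : B := Structure.funMap (L := lang) Func.sup ![a, b]

variable {α : Type} {k : ℕ} {v : α → B} {xs : Fin k → B}

theorem realize_tBot_raw : (tBot : Tm α k).realize (Sum.elim v xs) = opBot B :=
  congrArg (Structure.funMap (L := lang) Func.bot) (funext fun i => i.elim0)

theorem realize_tTop_raw : (tTop : Tm α k).realize (Sum.elim v xs) = opTop B :=
  congrArg (Structure.funMap (L := lang) Func.top) (funext fun i => i.elim0)

theorem realize_tCompl_raw (t : Tm α k) :
    (tCompl t).realize (Sum.elim v xs) = opCompl (t.realize (Sum.elim v xs)) :=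
  congrArg (Structure.funMap (L := lang) Func.compl) (funext fun i => by fin_cases i; rfl)

theorem realize_tInf_raw (s t : Tm α k) : (tInf s t).realize (Sum.elim v xs) =
    opInf (s.realize (Sum.elim v xs)) (t.realize (Sum.elim v xs)) :=
  congrArg (Structure.funMap (L := lang) Func.inf) (funext fun i => by fin_cases i <;> rfl)

theorem realize_tSup_raw (s t : Tm α k) : (tSup s t).realize (Sum.elim v xs) =
    opSup (s.realize (Sum.elim v xs)) (t.realize (Sum.elim v xs)) :=
  congrArg (Structure.funMap (L := lang) Func.sup) (funext fun i => by fin_cases i <;> rfl)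

/-- Phrased with the raw operations, since an arbitrary model carries no order yet; the equations on
the right are what is needed to construct one. -/
theorem model_booleanAxioms_iff : B ⊨ booleanAxioms ↔
    (∀ a b : B, opInf a b = opInf b a) ∧ (∀ a b : B, opSup a b = opSup b a) ∧
    (∀ a b c : B, opInf (opInf a b) c = opInf a (opInf b c)) ∧
    (∀ a b c : B, opSup (opSup a b) c = opSup a (opSup b c)) ∧
    (∀ a b : B, opInf a (opSup a b) = a) ∧ (∀ a b : B, opSup a (opInf a b) = a) ∧
    (∀ a b c : B, opInf a (opSup b c) = opSup (opInf a b) (opInf a c)) ∧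
    (∀ a b c : B, opSup a (opInf b c) = opInf (opSup a b) (opSup a c)) ∧
    (∀ a : B, opSup a (opBot B) = a) ∧ (∀ a : B, opInf a (opTop B) = a) ∧
    (∀ a : B, opInf a (opCompl a) = opBot B) ∧ (∀ a : B, opSup a (opCompl a) = opTop B) := by
  simp only [booleanAxioms, Theory.model_iff, Set.mem_insert_iff, Set.mem_singleton_iff,
    forall_eq_or_imp, forall_eq]
  refine Iff.trans (and_congr realize_sentence_all₂ <| and_congr realize_sentence_all₂ <|
    and_congr realize_sentence_all₃ <| and_congr realize_sentence_all₃ <|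
    and_congr realize_sentence_all₂ <| and_congr realize_sentence_all₂ <|
    and_congr realize_sentence_all₃ <| and_congr realize_sentence_all₃ <|
    and_congr realize_sentence_all <| and_congr realize_sentence_all <|
    and_congr realize_sentence_all realize_sentence_all) ?_
  simp only [BoundedFormula.realize_bdEqual, realize_tBot_raw, realize_tTop_raw,
    realize_tCompl_raw, realize_tInf_raw, realize_tSup_raw, realize_x]
  rfl

theorem OpsAgree.model_booleanAxioms [BooleanAlgebra B] (H : OpsAgree B) :
    B ⊨ booleanAxioms := by
  have h1 : opBot B = ⊥ := H.bot _
  have h2 : opTop B = ⊤ := H.top _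
  have h3 (a : B) : opCompl a = aᶜ := H.compl _
  have h4 (a b : B) : opInf a b = a ⊓ b := H.inf _
  have h5 (a b : B) : opSup a b = a ⊔ b := H.sup _
  rw [model_booleanAxioms_iff]
  simp only [h1, h2, h3, h4, h5]
  exact ⟨inf_comm, sup_comm, inf_assoc, sup_assoc, fun _ _ => inf_sup_self,
    fun _ _ => sup_inf_self, inf_sup_left, sup_inf_left, sup_bot_eq, inf_top_eq,
    inf_compl_self, fun _ => sup_compl_eq_top⟩

/-- The order is not part of the language; the absorption laws recover it from the two operations.
-/
theorem exists_opsAgree (h : B ⊨ booleanAxioms) : ∃ _ : BooleanAlgebra B, OpsAgree B := by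
  rw [model_booleanAxioms_iff] at h
  obtain ⟨ic, sc, ia, sa, isf, sif, isl, sil, sb, it, icp, scp⟩ := h
  let : Max B := ⟨opSup⟩
  let : Min B := ⟨opInf⟩
  let L : Lattice B := Lattice.mk' sc sa ic ia sif isf
  let D : DistribLattice B := { L with le_sup_inf := fun a b c => (sil a b c).ge }
  let A : BooleanAlgebra B := { D with
    bot := opBot B
    top := opTop B
    compl := opCompl
    le_top := fun a => inf_eq_left.1 (it a)
    bot_le := fun a => sup_eq_left.1 (sb a)
    inf_compl_le_bot := fun a => (icp a).le
    top_le_sup_compl := fun a => (scp a).ge }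
  refine ⟨A, ⟨fun a => ?_, fun a => ?_, fun a => ?_, fun a => ?_, fun a => ?_⟩⟩
  · exact congrArg (Structure.funMap (L := lang) Func.bot) (funext fun i => i.elim0)
  · exact congrArg (Structure.funMap (L := lang) Func.top) (funext fun i => i.elim0)
  · exact congrArg (Structure.funMap (L := lang) Func.compl) (funext fun i => by fin_cases i; rfl)
  · exact congrArg (Structure.funMap (L := lang) Func.inf)
      (funext fun i => by fin_cases i <;> rfl)
  · exact congrArg (Structure.funMap (L := lang) Func.sup)
      (funext fun i => by fin_cases i <;> rfl)

end RawOperations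

theorem IsPresburgerAlgebra.model [BooleanAlgebra B] (H : IsPresburgerAlgebra B) : B ⊨ T₃ := by
  have O := H.toOpsAgree
  rw [model_T₃_iff]
  refine ⟨O.model_booleanAxioms, H.infinite, ?_, fun n => ?_, ?_, fun n => ?_, ?_, ?_⟩
  · rw [atomicAxiom, realize_sentence_all]
    intro b
    simpa [realize_fAtom O, realize_fLe O, realize_tBot O, snoc_vec_one] using H.exists_atom b
  · rw [cAxiom, realize_sentence_all]
    intro b
    rw [BoundedFormula.realize_iff, realize_fAtLeastAtoms O, realize_fC]
    exact H.hasC_iff n b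
  · rw [Theory.model_iff]
    rintro φ (rfl | rfl | rfl | rfl)
    · simpa [Sentence.Realize, Formula.Realize, realize_tBot O] using H.fin_bot
    · rw [realize_sentence_all₂]
      intro a b
      simpa [realize_fLe O] using H.fin_mono a b
    · rw [realize_sentence_all₂]
      intro a b
      simpa [realize_tSup O] using H.fin_sup a b
    · simpa [Sentence.Realize, Formula.Realize, realize_tTop O] using H.not_fin_top
  · rw [smallAxiom, realize_sentence_all]
    intro b
    rw [BoundedFormula.realize_imp, realize_fSharpLe H.hasC_iff, realize_fFin]
    exact H.fin_of_atomCount_le n b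
  · rw [mainAxiom, realize_sentence_all]
    intro b
    simpa [realize_fLt O, realize_tInf O, realize_tCompl O, snoc_vec_one, and_assoc]
      using H.exists_split b
  · rintro φ (⟨n, r⟩ | ⟨n, r, m, h⟩ | ⟨n, r, s, h⟩ | ⟨n, r, s, h⟩ | ⟨n, m, r, h⟩ | n | ⟨n, r, s⟩ |
      ⟨n, r⟩)
    · rw [realize_sentence_all]
      intro b
      simpa using H.fin_of_res n r b
    · rw [realize_sentence_all]
      intro b
      simp only [BoundedFormula.realize_imp, BoundedFormula.realize_inf, realize_fFin,
        realize_fSharpEq H.hasC_iff, realize_fRes]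
      rintro ⟨h1, h2⟩
      exact H.res_congr n m r _ h (H.res_of_atomCount n m _ h1 h2)
    · rw [realize_sentence_all]
      intro b
      simpa using H.res_congr n r s b h
    · rw [realize_sentence_all]
      intro b
      simpa using fun h1 h2 => h (H.res_unique n r s b h1 h2)
    · rw [realize_sentence_all]
      intro b
      simpa using H.res_dvd n m r b h
    · rw [realize_sentence_all]
      intro b
      simp only [BoundedFormula.realize_imp, realize_fFin, BoundedFormula.realize_iSup,
        realize_fRes]
      intro hb
      obtain ⟨r, hr, h⟩ := H.exists_res n _ hb
      exact ⟨⟨r, hr⟩, h⟩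
    · rw [realize_sentence_all₂]
      intro a b
      simpa [realize_tInf O, realize_tSup O, realize_tBot O] using H.res_sup n r s a b
    · rw [realize_sentence_all₂]
      intro a b
      simp only [BoundedFormula.realize_imp, BoundedFormula.realize_inf, realize_fRes,
        BoundedFormula.realize_iSup, BoundedFormula.realize_bdEqual, realize_tInf O,
        realize_tSup O, realize_tBot O]
      rintro ⟨h0, h1⟩
      obtain ⟨s, t, hs, ht, h⟩ := H.res_split n r _ _ h0 h1
      exact ⟨⟨⟨⟨s, hs⟩, ⟨t, ht⟩⟩, h.1⟩, h.2⟩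

theorem OpsAgree.isPresburgerAlgebra [BooleanAlgebra B] (O : OpsAgree B) (h : B ⊨ T₃) :
    IsPresburgerAlgebra B := by
  rw [model_T₃_iff] at h
  obtain ⟨-, hinf, hat, hc, hpi, hsm, hmain, hbp⟩ := h
  have hC (n : ℕ+) (b : B) : HasC n b ↔ ((n : ℕ) : ℕ∞) ≤ atomCount b := by
    have := realize_sentence_all.1 (hc n) b
    rwa [BoundedFormula.realize_iff, realize_fAtLeastAtoms O, realize_fC] at this
  simp only [properIdealAxioms, Theory.model_iff, Set.mem_insert_iff, Set.mem_singleton_iff,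
    forall_eq_or_imp, forall_eq, realize_sentence_all₂] at hpi
  obtain ⟨h1, h2, h3, h4⟩ := hpi
  refine { O with
    infinite := hinf
    exists_atom := fun b => ?_
    hasC_iff := hC
    fin_bot := ?_
    fin_mono := fun a b => ?_
    fin_sup := fun a b => ?_
    not_fin_top := ?_
    fin_of_atomCount_le := fun n b => ?_
    exists_split := fun b => ?_
    fin_of_res := fun n r b => ?_
    res_of_atomCount := fun n m b ha hm => ?_
    res_congr := fun n r s b hrs => ?_
    res_unique := fun n r s b hr hs => ?_
    res_dvd := fun n m r b hd => ?_
    exists_res := fun n b hb => ?_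
    res_sup := fun n r s a b => ?_
    res_split := fun n r a b h0 hr => ?_ }
  · simpa [realize_fAtom O, realize_fLe O, realize_tBot O, snoc_vec_one]
      using realize_sentence_all.1 hat b
  · simpa [Sentence.Realize, Formula.Realize, realize_tBot O] using h1
  · simpa [realize_fLe O] using h2 a b
  · simpa [realize_tSup O] using h3 a b
  · simpa [Sentence.Realize, Formula.Realize, realize_tTop O] using h4
  · have := realize_sentence_all.1 (hsm n) b
    rwa [BoundedFormula.realize_imp, realize_fSharpLe hC, realize_fFin] at this
  · simpa [realize_fLt O, realize_tInf O, realize_tCompl O, snoc_vec_one, and_assoc]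
      using realize_sentence_all.1 hmain b
  · simpa using realize_sentence_all.1 (hbp _ (.fin n r)) b
  · have := realize_sentence_all.1 (hbp _ (.card n m m rfl)) b
    simp only [BoundedFormula.realize_imp, BoundedFormula.realize_inf, realize_fFin,
      realize_fSharpEq hC, realize_fRes] at this
    exact this ⟨ha, hm⟩
  · simpa using realize_sentence_all.1 (hbp _ (.congr n r s hrs)) b
  · by_contra hrs
    have := realize_sentence_all.1 (hbp _ (.incongr n r s hrs)) b
    simp only [BoundedFormula.realize_imp, BoundedFormula.realize_not, realize_fRes] at this
    exact this hr hs
  · simpa using realize_sentence_all.1 (hbp _ (.dvd n m r hd)) b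
  · have := realize_sentence_all.1 (hbp _ (.exists_res n)) b
    simp only [BoundedFormula.realize_imp, realize_fFin, BoundedFormula.realize_iSup,
      realize_fRes] at this
    obtain ⟨r, h⟩ := this hb
    exact ⟨r, r.2, h⟩
  · simpa [realize_tInf O, realize_tSup O, realize_tBot O]
      using realize_sentence_all₂.1 (hbp _ (.add n r s)) a b
  · have := realize_sentence_all₂.1 (hbp _ (.split n r)) a b
    simp only [BoundedFormula.realize_imp, BoundedFormula.realize_inf, realize_fRes,
      BoundedFormula.realize_iSup, BoundedFormula.realize_bdEqual, realize_tInf O,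
      realize_tSup O, realize_tBot O] at this
    obtain ⟨⟨⟨s, t⟩, h⟩, h'⟩ := this ⟨h0, hr⟩
    exact ⟨s, t, s.2, t.2, h, h'⟩

theorem exists_isPresburgerAlgebra (h : B ⊨ T₃) :
    ∃ _ : BooleanAlgebra B, IsPresburgerAlgebra B := by
  obtain ⟨i, O⟩ := exists_opsAgree (model_T₃_iff.1 h).1
  exact ⟨i, O.isPresburgerAlgebra h⟩

/-- The atoms of a powerset are the singletons. -/
theorem atomCount_set {I : Type*} (s : Set I) : atomCount s = s.encard := by
  have : {a : Set I | IsAtom a ∧ a ≤ s} = (fun i => {i}) '' s := by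
    ext a
    simp only [Set.mem_ofPred_eq, Set.isAtom_iff, Set.mem_image]
    constructor
    · rintro ⟨⟨i, rfl⟩, h⟩
      exact ⟨i, by simpa using h, rfl⟩
    · rintro ⟨i, hi, rfl⟩
      exact ⟨⟨i, rfl⟩, by simpa using hi⟩
  rw [atomCount, this, Set.singleton_injective.encard_image]

theorem isPresburgerAlgebra_set (I : Type*) [Infinite I] : IsPresburgerAlgebra (Set I) := by
  have hc := atomCount_set (I := I)
  have hF (s : Set I) : IsFin s ↔ s.Finite := Iff.rfl
  have hR (n : ℕ+) (r : ℤ) (s : Set I) :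
    HasRes n r s ↔ s.Finite ∧ (s.ncard : ℤ) ≡ r [ZMOD (n : ℤ)] := Iff.rfl
  exact {
    bot := fun _ => rfl
    top := fun _ => rfl
    compl := fun _ => rfl
    inf := fun _ => rfl
    sup := fun _ => rfl
    infinite := inferInstance
    exists_atom := fun b hb => IsAtomic.eq_bot_or_exists_atom_le b |>.resolve_left hb
    hasC_iff := fun n b => by rw [hc]; exact Iff.rfl
    fin_bot := Set.finite_empty
    fin_mono := fun _ _ h hs => Set.Finite.subset h hs
    fin_sup := fun _ _ h1 h2 => Set.Finite.union h1 h2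
    not_fin_top := Set.infinite_univ
    fin_of_atomCount_le := fun n b h => by
      rw [hc] at h
      exact Set.finite_of_encard_le_coe h
    exists_split := fun b hb => by
      -- An infinite set is the disjoint union of two equinumerous parts; if one were finite, so
      -- would be the other and the union.
      obtain ⟨t, u, rfl, hd, hcard⟩ :=
        Set.Infinite.exists_union_disjoint_cardinal_eq_of_infinite (s := b) hb
      obtain ⟨e⟩ := Cardinal.eq.1 hcard
      have htu : t.Finite ↔ u.Finite := by
        rw [← Set.finite_coe_iff, ← Set.finite_coe_iff, e.finite_iff]
      have h1 : t.Infinite := fun h => hb (h.union (htu.1 h))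
      have h2 : u.Infinite := fun h => h1 (htu.2 h)
      have h3 : (t ∪ u) ∩ tᶜ = u := by
        rw [← Set.sdiff_eq, Set.union_sdiff_cancel_left hd.le_bot]
      refine ⟨t, lt_of_le_of_ne Set.subset_union_left fun h => ?_, h1, ?_⟩
      · have h4 : (t ∪ u) ∩ tᶜ = ∅ := by rw [← h]; exact Set.inter_compl_self t
        rw [h3] at h4
        exact h2.nonempty.ne_empty h4
      · show ((t ∪ u) ∩ tᶜ).Infinite
        rwa [h3]
    fin_of_res := fun _ _ _ h => h.1
    res_of_atomCount := fun n m b hb h => by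
      rw [hc] at h
      refine ⟨hb, ?_⟩
      show ((b.ncard : ℕ) : ℤ) ≡ _ [ZMOD _]
      rw [Set.ncard, h]; rfl
    res_congr := fun n r s b h hr => ⟨hr.1, hr.2.trans h⟩
    res_unique := fun n r s b hr hs => hr.2.symm.trans hs.2
    res_dvd := fun n m r b hd h => ⟨h.1, h.2.of_dvd (Int.natCast_dvd_natCast.2 hd)⟩
    exists_res := fun n b hb => ⟨b.ncard % n, Nat.mod_lt _ n.pos, hb, by
      show ((b.ncard : ℕ) : ℤ) ≡ _ [ZMOD _]
      push_cast
      exact (Int.mod_modEq _ _).symm⟩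
    res_sup := fun n r s a b h0 hr hs => by
      refine ⟨hr.1.union hs.1, ?_⟩
      show (((a ∪ b).ncard : ℕ) : ℤ) ≡ _ [ZMOD _]
      rw [Set.ncard_union_eq (Set.disjoint_iff_inter_eq_empty.2 h0) hr.1 hs.1]
      push_cast
      exact hr.2.add hs.2
    res_split := fun n r a b h0 hr => by
      have h1 : a.Finite := hr.1.subset Set.subset_union_left
      have h2 : b.Finite := hr.1.subset Set.subset_union_right
      refine ⟨a.ncard % n, b.ncard % n, Nat.mod_lt _ n.pos, Nat.mod_lt _ n.pos, ?_, ⟨h1, ?_⟩,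
        ⟨h2, ?_⟩⟩
      · refine Int.ModEq.trans ?_ hr.2
        show _ ≡ (((a ∪ b).ncard : ℕ) : ℤ) [ZMOD _]
        rw [Set.ncard_union_eq (Set.disjoint_iff_inter_eq_empty.2 h0) h1 h2]
        push_cast
        exact (Int.mod_modEq _ _).add (Int.mod_modEq _ _)
      · show ((a.ncard : ℕ) : ℤ) ≡ _ [ZMOD _]
        push_cast
        exact (Int.mod_modEq _ _).symm
      · show ((b.ncard : ℕ) : ℤ) ≡ _ [ZMOD _]
        push_cast
        exact (Int.mod_modEq _ _).symm }

end Models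

/-! ### Arithmetic of the number of atoms. -/

section AtomCount

variable {B : Type*} [BooleanAlgebra B]

/-- An atom that is not below `b` is disjoint from `b`, so from `b ⊔ c` it falls below `c`. -/
theorem supPrime_of_isAtom {a : B} (ha : IsAtom a) : SupPrime a := by
  refine ⟨fun h => ha.1 (isMin_iff_eq_bot.1 h), fun b c h => ?_⟩
  rw [or_iff_not_imp_left]
  exact fun hb => (ha.not_le_iff_disjoint.1 hb).left_le_of_le_sup_left h

theorem atomCount_sup {a b : B} (h : a ⊓ b = ⊥) :
    atomCount (a ⊔ b) = atomCount a + atomCount b := by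
  rw [atomCount, atomCount, atomCount, ← Set.encard_union_eq]
  · congr 1
    ext c
    simp only [Set.mem_ofPred_eq, Set.mem_union, ← and_or_left]
    exact and_congr_right fun hc => (supPrime_of_isAtom hc).le_sup
  · rw [Set.disjoint_left]
    rintro c ⟨h1, h2⟩ ⟨-, h3⟩
    exact h1.1 (le_bot_iff.1 (h ▸ le_inf h2 h3))

theorem atomCount_add_sdiff {a b : B} (h : a ≤ b) :
    atomCount a + atomCount (b \ a) = atomCount b := by
  rw [← atomCount_sup inf_sdiff_self_right, sup_sdiff_cancel_right h]

/-- The join of `n` chosen atoms below `b` works: atoms are prime, so an atom below a finite join of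
atoms is one of them. -/
theorem exists_le_atomCount_eq {b : B} {n : ℕ} (h : (n : ℕ∞) ≤ atomCount b) :
    ∃ a ≤ b, atomCount a = n := by
  obtain ⟨t, ht, hn⟩ := Set.exists_subset_encard_eq h
  have hfin : t.Finite := Set.finite_of_encard_eq_coe hn
  lift t to Finset B using hfin
  refine ⟨t.sup id, Finset.sup_le fun c hc => (ht hc).2, ?_⟩
  rw [← hn, atomCount]
  congr 1
  ext c
  constructor
  · rintro ⟨h1, h2⟩
    obtain ⟨d, hd, hcd⟩ := (supPrime_of_isAtom h1).le_finset_sup.1 h2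
    rcases (ht hd).1.le_iff.1 hcd with h | h
    · exact absurd h h1.1
    · rwa [h]
  · exact fun hc => ⟨(ht hc).1, Finset.le_sup (f := id) hc⟩

end AtomCount

namespace IsPresburgerAlgebra

variable {B : Type*} [BooleanAlgebra B] [lang.Structure B] (H : IsPresburgerAlgebra B)
include H

theorem atomCount_eq_zero_iff {b : B} : atomCount b = 0 ↔ b = ⊥ := by
  rw [atomCount, Set.encard_eq_zero]
  constructor
  · intro h
    by_contra hb
    obtain ⟨a, ha⟩ := H.exists_atom b hb
    exact (h ▸ ha : a ∈ (∅ : Set B))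
  · rintro rfl
    ext a
    simp only [Set.mem_ofPred_eq, le_bot_iff, Set.mem_empty_iff_false, iff_false, not_and]
    exact fun h => h.1

theorem fin_sup_iff {a b : B} : IsFin (a ⊔ b) ↔ IsFin a ∧ IsFin b :=
  ⟨fun h => ⟨H.fin_mono _ _ h le_sup_left, H.fin_mono _ _ h le_sup_right⟩,
    fun h => H.fin_sup _ _ h.1 h.2⟩

/-- Contrapositive of the axiom that elements with few atoms lie in `Fin`. -/
theorem le_atomCount {b : B} (h : ¬ IsFin b) (n : ℕ) : (n : ℕ∞) ≤ atomCount b := by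
  by_contra hn
  exact h (H.fin_of_atomCount_le n b (not_le.1 hn).le)

theorem res_congr_iff {n : ℕ+} {r s : ℤ} {b : B} (h : r ≡ s [ZMOD (n : ℤ)]) :
    HasRes n r b ↔ HasRes n s b :=
  ⟨H.res_congr n r s b h, H.res_congr n s r b h.symm⟩

theorem res_iff_of_res {n : ℕ+} {r s : ℤ} {b : B} (h : HasRes n r b) :
    HasRes n s b ↔ r ≡ s [ZMOD (n : ℤ)] :=
  ⟨H.res_unique n r s b h, fun hrs => H.res_congr n r s b hrs h⟩

theorem res_iff_of_atomCount {n : ℕ+} {m : ℕ} {r : ℤ} {b : B} (h : atomCount b = m) :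
    HasRes n r b ↔ (m : ℤ) ≡ r [ZMOD (n : ℤ)] :=
  H.res_iff_of_res (H.res_of_atomCount n m b (H.fin_of_atomCount_le m b h.le) h)

/-- The addition and the splitting axiom together make the residues of a disjoint join a function of
those of its parts, which is what compatibility of similarity with joins requires. -/
theorem res_sup_iff {n : ℕ+} {r : ℤ} {a b : B} (h : a ⊓ b = ⊥) :
    HasRes n r (a ⊔ b) ↔ ∃ s : ℤ, HasRes n s a ∧ HasRes n (r - s) b := by
  constructor
  · intro hr
    obtain ⟨s, t, -, -, hst, hs, ht⟩ := H.res_split n r a b h hr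
    refine ⟨s, hs, H.res_congr n t _ b ?_ ht⟩
    have := hst.sub_right (s : ℤ)
    simpa using this
  · rintro ⟨s, hs, ht⟩
    simpa using H.res_sup n s (r - s) a b h hs ht

end IsPresburgerAlgebra

/-! ### Similarity of elements and its back-and-forth property. -/

/-- Two elements of structures for `lang` agree on `C_n` for `n ≤ N`, on `Fin` and on the residues
modulo `M`. -/
structure Similar (N : ℕ) (M : ℕ+) {A B : Type*} [BooleanAlgebra A] [lang.Structure A]
    [BooleanAlgebra B] [lang.Structure B] (a : A) (b : B) : Prop where
  count (n : ℕ) : n ≤ N → ((n : ℕ∞) ≤ atomCount a ↔ (n : ℕ∞) ≤ atomCount b)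
  fin : IsFin a ↔ IsFin b
  res (r : ℤ) : HasRes M r a ↔ HasRes M r b

section Similar

variable {A B : Type*} [BooleanAlgebra A] [lang.Structure A] [BooleanAlgebra B] [lang.Structure B]
  {N N' : ℕ} {M : ℕ+} {a a' : A} {b b' : B}

theorem Similar.symm (h : Similar N M a b) : Similar N M b a :=
  ⟨fun n hn => (h.count n hn).symm, h.fin.symm, fun r => (h.res r).symm⟩

theorem Similar.mono (h : Similar N M a b) (hN : N' ≤ N) : Similar N' M a b :=
  ⟨fun n hn => h.count n (hn.trans hN), h.fin, h.res⟩

/-- Truncated addition is well defined: `n ≤ c + d` means that `n` is a sum of some `i ≤ c` and `j ≤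
d`, and both summands are again at most `N`. -/
theorem count_add_iff {N : ℕ} {c d c' d' : ℕ∞}
    (h1 : ∀ n : ℕ, n ≤ N → ((n : ℕ∞) ≤ c ↔ (n : ℕ∞) ≤ c'))
    (h2 : ∀ n : ℕ, n ≤ N → ((n : ℕ∞) ≤ d ↔ (n : ℕ∞) ≤ d')) (n : ℕ) (hn : n ≤ N) :
    (n : ℕ∞) ≤ c + d ↔ (n : ℕ∞) ≤ c' + d' := by
  have key (c d : ℕ∞) : (n : ℕ∞) ≤ c + d ↔
      ∃ i j : ℕ, i + j = n ∧ (i : ℕ∞) ≤ c ∧ (j : ℕ∞) ≤ d := by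
    constructor
    · intro h
      induction c with
      | top => exact ⟨n, 0, by simp⟩
      | coe c =>
        induction d with
        | top => exact ⟨0, n, by simp⟩
        | coe d =>
          norm_cast at h
          exact ⟨min n c, n - min n c, by omega, by norm_cast; omega, by norm_cast; omega⟩
    · rintro ⟨i, j, rfl, hi, hj⟩
      push_cast
      exact add_le_add hi hj
  rw [key, key]
  refine exists₂_congr fun i j => and_congr_right fun hij => ?_
  rw [h1 i (by omega), h2 j (by omega)]

variable (HA : IsPresburgerAlgebra A) (HB : IsPresburgerAlgebra B)
include HA HB

theorem Similar.sup (h : Similar N M a b) (h' : Similar N M a' b') (ha : a ⊓ a' = ⊥)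
    (hb : b ⊓ b' = ⊥) : Similar N M (a ⊔ a') (b ⊔ b') where
  count := by
    rw [atomCount_sup ha, atomCount_sup hb]
    exact count_add_iff h.count h'.count
  fin := by rw [HA.fin_sup_iff, HB.fin_sup_iff, h.fin, h'.fin]
  res r := by simp only [HA.res_sup_iff ha, HB.res_sup_iff hb, h.res, h'.res]

theorem similar_bot : Similar N M (⊥ : A) (⊥ : B) := by
  have h1 := HA.atomCount_eq_zero_iff.2 rfl
  have h2 := HB.atomCount_eq_zero_iff.2 rfl
  refine ⟨fun n _ => by rw [h1, h2], iff_of_true HA.fin_bot HB.fin_bot, fun r => ?_⟩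
  rw [HA.res_iff_of_atomCount (m := 0) (by simpa using h1),
    HB.res_iff_of_atomCount (m := 0) (by simpa using h2)]

/-- This and the next two lemmas are the ways to certify similarity: equal finite numbers of atoms,
both elements outside `Fin`, or both in `Fin` with at least `N` atoms and a common residue. -/
theorem similar_of_atomCount_eq {m : ℕ} (ha : atomCount a = m) (hb : atomCount b = m) :
    Similar N M a b := by
  refine ⟨fun n _ => by rw [ha, hb], iff_of_true (HA.fin_of_atomCount_le m a ha.le)
    (HB.fin_of_atomCount_le m b hb.le), fun r => ?_⟩
  rw [HA.res_iff_of_atomCount ha, HB.res_iff_of_atomCount hb]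

theorem similar_of_not_fin (ha : ¬ IsFin a) (hb : ¬ IsFin b) : Similar N M a b :=
  ⟨fun n _ => iff_of_true (HA.le_atomCount ha n) (HB.le_atomCount hb n), iff_of_false ha hb,
    fun _ => iff_of_false (fun h => ha (HA.fin_of_res _ _ _ h))
      (fun h => hb (HB.fin_of_res _ _ _ h))⟩

theorem similar_of_res {r : ℤ} (ha : (N : ℕ∞) ≤ atomCount a) (hb : (N : ℕ∞) ≤ atomCount b)
    (hra : HasRes M r a) (hrb : HasRes M r b) : Similar N M a b := by
  have hN (n : ℕ) (hn : n ≤ N) : (n : ℕ∞) ≤ N := Nat.cast_le.2 hn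
  refine ⟨fun n hn => iff_of_true ((hN n hn).trans ha) ((hN n hn).trans hb),
    iff_of_true (HA.fin_of_res _ _ _ hra) (HB.fin_of_res _ _ _ hrb), fun s => ?_⟩
  rw [HA.res_iff_of_res hra, HB.res_iff_of_res hrb]

/-- An element of `Fin` is similar to all elements with a certain small finite number of atoms. -/
theorem exists_small_count (N : ℕ) (M : ℕ+) (ha : IsFin a) : ∃ n : ℕ, n < N + M ∧
    ∀ b : B, atomCount b = n → Similar N M a b := by
  by_cases hN : (N : ℕ∞) ≤ atomCount a
  · obtain ⟨r, -, hr⟩ := HA.exists_res M a ha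
    have hM : (0 : ℤ) < M := by exact_mod_cast M.pos
    have h1 := Int.emod_nonneg ((r : ℤ) - N) hM.ne'
    have h2 := Int.emod_lt_of_pos ((r : ℤ) - N) hM
    obtain ⟨k, hk⟩ := Int.eq_ofNat_of_zero_le h1
    have hkM : k < M := by zify; omega
    -- Here `k` is the remainder of `r - N` modulo `M`, so that `N + k` is at least `N` and has the
    -- residue `r` of `a`.
    refine ⟨N + k, by omega, fun b hb => ?_⟩
    refine similar_of_res HA HB (r := r) hN (by rw [hb]; exact_mod_cast Nat.le_add_right N k) hr ?_
    rw [HB.res_iff_of_atomCount hb]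
    have h3 : (k : ℤ) ≡ r - N [ZMOD (M : ℤ)] := by
      rw [show (k : ℤ) = (r - N) % (M : ℤ) from hk.symm]
      exact Int.mod_modEq _ _
    simpa using h3.add_left (N : ℤ)
  -- With fewer than `N` atoms, the exact number of atoms of `a` is the witness.
  · obtain ⟨m, hm⟩ := ENat.ne_top_iff_exists.1 (not_le.1 hN).ne_top
    rw [← hm] at hN
    have : m < N := by simpa using hN
    exact ⟨m, by omega, fun b hb => similar_of_atomCount_eq HA HB hm.symm hb⟩

/-- Similar elements, one of which is split into a small and a large part, have similar
decompositions. -/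
theorem Similar.exists_split_of_le (h : Similar (2 * N + M) M a b) (ha : a' ≤ a)
    (hfin : IsFin a') (hlarge : (N : ℕ∞) ≤ atomCount (a \ a'))
    (hb : ((2 * N + M : ℕ) : ℕ∞) ≤ atomCount b) :
    ∃ b' ≤ b, Similar N M a' b' ∧ Similar N M (a \ a') (b \ b') := by
  obtain ⟨n, hn, hs⟩ := exists_small_count HA HB N M hfin
  obtain ⟨b', hb', hc⟩ := exists_le_atomCount_eq (b := b) (n := n)
    (le_trans (by exact_mod_cast (by omega : n ≤ 2 * N + M)) hb)
  have hab := hs b' hc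
  refine ⟨b', hb', hab, ?_⟩
  have hfin' := hab.fin.1 hfin
  have ea : a' ⊔ a \ a' = a := by rw [sup_sdiff_cancel_right ha]
  have eb : b' ⊔ b \ b' = b := by rw [sup_sdiff_cancel_right hb']
  by_cases hfa : IsFin a
  -- Of the at least `2 * N + M` atoms of `b`, fewer than `N + M` went into `b'`; this is where the
  -- constant comes from.
  · have hlarge' : (N : ℕ∞) ≤ atomCount (b \ b') := by
      rw [← atomCount_add_sdiff hb', hc] at hb
      by_contra hlt
      obtain ⟨m, hm⟩ := ENat.ne_top_iff_exists.1 (not_le.1 hlt).ne_top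
      rw [← hm] at hb hlt
      norm_cast at hb hlt
      omega
    rw [← ea, HA.fin_sup_iff] at hfa
    obtain ⟨r, -, hr⟩ := HA.exists_res M _ hfa.1
    obtain ⟨s, -, hs⟩ := HA.exists_res M _ hfa.2
    refine similar_of_res HA HB (r := s) hlarge hlarge' hs ?_
    -- The residue of `b \ b'` is forced: `a` and `b` share the residue `r + s`, and `a'` and `b'`
    -- share `r`, so subtraction leaves `s`.
    have h1 := HA.res_sup M r s _ _ inf_sdiff_self_right hr hs
    rw [ea, h.res, ← eb, HB.res_sup_iff inf_sdiff_self_right] at h1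
    obtain ⟨t, ht, h2⟩ := h1
    have h3 := HB.res_unique M _ _ _ ht ((hab.res r).1 hr)
    refine HB.res_congr M _ _ _ ?_ h2
    simpa using h3.symm.sub_left ((r : ℤ) + s) |>.symm
  -- Removing an element of `Fin` from one outside `Fin` leaves an element outside `Fin`.
  · refine similar_of_not_fin HA HB (fun h' => hfa ?_) (fun h' => hfa (h.fin.2 ?_))
    · rw [← ea]; exact HA.fin_sup _ _ hfin h'
    · rw [← eb]; exact HB.fin_sup _ _ hfin' h'

/-- The back-and-forth property of similarity. -/
theorem Similar.exists_split (h : Similar (2 * N + M) M a b) (ha : a' ≤ a) :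
    ∃ b' ≤ b, Similar N M a' b' ∧ Similar N M (a \ a') (b \ b') := by
  have ea : a' ⊔ a \ a' = a := by rw [sup_sdiff_cancel_right ha]
  by_cases hsmall : ((2 * N + M : ℕ) : ℕ∞) ≤ atomCount a
  · have hb := (h.count _ le_rfl).1 hsmall
    by_cases h1 : IsFin a' ∧ (N : ℕ∞) ≤ atomCount (a \ a')
    · exact h.exists_split_of_le HA HB ha h1.1 h1.2 hb
    -- The mirror image of the previous case, with the two parts exchanged.
    by_cases h2 : IsFin (a \ a') ∧ (N : ℕ∞) ≤ atomCount a'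
    · have e : a \ (a \ a') = a' := by rw [sdiff_sdiff_right_self, inf_eq_right.2 ha]
      obtain ⟨b', hb', h3, h4⟩ :=
        h.exists_split_of_le HA HB sdiff_le h2.1 (by rw [e]; exact h2.2) hb
      rw [e] at h4
      refine ⟨b \ b', sdiff_le, h4, ?_⟩
      rwa [sdiff_sdiff_right_self, inf_eq_right.2 hb']
    -- In the remaining case both parts lie outside `Fin`: otherwise each would have fewer than `N`
    -- atoms, against the `2 * N + M` atoms of `a`. The splitting axiom then cuts `b`.
    · have f1 : ¬ IsFin a' := by
        intro hf
        have h3 : ¬ (N : ℕ∞) ≤ atomCount (a \ a') := fun h => h1 ⟨hf, h⟩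
        have h4 : IsFin (a \ a') := by
          by_contra h4
          exact h3 (HA.le_atomCount h4 N)
        have h5 : ¬ (N : ℕ∞) ≤ atomCount a' := fun h => h2 ⟨h4, h⟩
        rw [← atomCount_add_sdiff ha] at hsmall
        obtain ⟨m, hm⟩ := ENat.ne_top_iff_exists.1 (not_le.1 h3).ne_top
        obtain ⟨n, hn⟩ := ENat.ne_top_iff_exists.1 (not_le.1 h5).ne_top
        rw [← hm] at hsmall h3
        rw [← hn] at hsmall h5
        norm_cast at hsmall h3 h5
        omega
      have f2 : ¬ IsFin (a \ a') := fun hf => h2 ⟨hf, HA.le_atomCount f1 N⟩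
      have fb : ¬ IsFin b := fun hf => f1 (HA.fin_mono _ _ (h.fin.2 hf) ha)
      obtain ⟨c, hc, g1, g2⟩ := HB.exists_split b fb
      refine ⟨c, hc.le, similar_of_not_fin HA HB f1 g1, similar_of_not_fin HA HB f2 ?_⟩
      rwa [sdiff_eq]
  · obtain ⟨m, hm⟩ := ENat.ne_top_iff_exists.1 (not_le.1 hsmall).ne_top
    -- Since `m + 1 ≤ 2 * N + M`, similarity also compares with `m + 1` and so determines the number
    -- exactly.
    have hbm : atomCount b = m := by
      rw [← hm] at hsmall
      norm_cast at hsmall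
      have h1 := (h.count m (by omega)).1 hm.le
      have h2 : ¬ ((m + 1 : ℕ) : ℕ∞) ≤ atomCount b := by
        rw [← h.count (m + 1) (by omega), ← hm]
        norm_cast
        omega
      refine le_antisymm ?_ h1
      rw [not_le] at h2
      push_cast at h2
      exact (ENat.lt_add_one_iff (ENat.natCast_ne_top m)).1 h2
    have hsum := atomCount_add_sdiff ha
    rw [← hm] at hsum
    obtain ⟨i, hi⟩ := ENat.ne_top_iff_exists.1
      (ne_top_of_le_ne_top (ENat.natCast_ne_top m) (hsum ▸ le_self_add : atomCount a' ≤ m))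
    obtain ⟨j, hj⟩ := ENat.ne_top_iff_exists.1
      (ne_top_of_le_ne_top (ENat.natCast_ne_top m) (hsum ▸ le_add_self : atomCount (a \ a') ≤ m))
    rw [← hi, ← hj] at hsum
    norm_cast at hsum
    obtain ⟨b', hb', hc⟩ := exists_le_atomCount_eq (b := b) (n := i)
      (by rw [hbm]; exact_mod_cast (by omega : i ≤ m))
    refine ⟨b', hb', similar_of_atomCount_eq HA HB hi.symm hc,
      similar_of_atomCount_eq HA HB hj.symm ?_⟩
    have h3 := atomCount_add_sdiff hb'
    rw [hc, hbm, ← hsum] at h3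
    push_cast at h3
    exact ENat.add_left_injective_of_ne_top (ENat.natCast_ne_top i) (by simpa [add_comm] using h3)

end Similar

/-! ### Minterms, atoms and the values of terms. -/

section Minterm

variable {ι : Type} [Fintype ι] {B : Type*} [BooleanAlgebra B]

/-- The meet of the elements of a tuple and of complements of such elements, as prescribed by a
pattern. -/
def minterm (x : ι → B) (p : ι → Bool) : B :=
  Finset.univ.inf fun i => if p i then x i else (x i)ᶜ

theorem le_minterm {x : ι → B} {p : ι → Bool} {b : B} :
    b ≤ minterm x p ↔ ∀ i, b ≤ if p i then x i else (x i)ᶜ := by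
  simp [minterm, Finset.le_inf_iff]

theorem minterm_le (x : ι → B) (p : ι → Bool) (i : ι) :
    minterm x p ≤ if p i then x i else (x i)ᶜ := le_minterm.1 le_rfl i

theorem disjoint_minterm {x : ι → B} {p q : ι → Bool} (h : p ≠ q) :
    Disjoint (minterm x p) (minterm x q) := by
  obtain ⟨i, hi⟩ := Function.ne_iff.1 h
  refine Disjoint.mono (minterm_le x p i) (minterm_le x q i) ?_
  cases hp : p i <;> cases hq : q i <;> simp_all [disjoint_compl_left, disjoint_compl_right]

/-- Adding an element to a tuple cuts each minterm in two; this reduces the extension of tuples to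
the splitting of single elements. -/
theorem minterm_snoc {α : Type} [Fintype α] {k : ℕ} (v : α → B) (xs : Fin k → B) (b : B)
    (q : α ⊕ Fin (k + 1) → Bool) :
    minterm (Sum.elim v (Fin.snoc xs b : Fin (k + 1) → B)) q =
      minterm (Sum.elim v xs) (q ∘ Sum.map id Fin.castSucc) ⊓
        if q (Sum.inr (Fin.last k)) then b else bᶜ := by
  refine eq_of_forall_le_iff fun c => ?_
  simp only [le_inf_iff, le_minterm, Sum.forall, Fin.forall_fin_succ', Sum.elim_inl, Sum.elim_inr,
    Fin.snoc_castSucc, Fin.snoc_last, Function.comp_apply, Sum.map_inl, Sum.map_inr, id, and_assoc]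
  rfl

theorem IsAtom.le_compl_iff {a b : B} (ha : IsAtom a) : a ≤ bᶜ ↔ ¬ a ≤ b := by
  rw [ha.not_le_iff_disjoint, le_compl_iff_disjoint_right]

open Classical in
/-- The pattern of a tuple at an atom. -/
noncomputable def pattern (x : ι → B) (a : B) : ι → Bool := fun i => decide (a ≤ x i)

theorem IsAtom.le_minterm_iff {x : ι → B} {p : ι → Bool} {a : B} (ha : IsAtom a) :
    a ≤ minterm x p ↔ pattern x a = p := by
  rw [le_minterm, funext_iff]
  refine forall_congr' fun i => ?_
  cases hp : p i <;> simp [pattern, IsAtom.le_compl_iff ha]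

theorem IsAtom.le_sup_minterm_iff {x : ι → B} {s : Finset (ι → Bool)} {a : B} (ha : IsAtom a) :
    a ≤ s.sup (minterm x) ↔ pattern x a ∈ s := by
  simp [(supPrime_of_isAtom ha).le_finset_sup, IsAtom.le_minterm_iff ha]

/-- The value of a term at a pattern. -/
def truth {ι : Type} (p : ι → Bool) : lang.Term ι → Bool
  | .var i => p i
  | .func (l := 0) Func.bot _ => false
  | .func (l := 0) Func.top _ => true
  | .func (l := 1) Func.compl ts => !truth p (ts 0)
  | .func (l := 2) Func.inf ts => truth p (ts 0) && truth p (ts 1)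
  | .func (l := 2) Func.sup ts => truth p (ts 0) || truth p (ts 1)

-- Being above a fixed atom is a homomorphism to the two-element algebra, because an atom is prime
-- and lies below exactly one of an element and its complement.
omit [Fintype ι] in
theorem OpsAgree.le_realize_iff [lang.Structure B] (H : OpsAgree B) {a : B} (ha : IsAtom a)
    (x : ι → B) (t : lang.Term ι) : a ≤ t.realize x ↔ truth (pattern x a) t = true := by
  induction t with
  | var i => simp [truth, pattern]
  | func f ts ih =>
    cases f with
    | bot =>
      rw [show Term.realize x (Term.func (L := lang) Func.bot ts) = ⊥ from H.bot _]
      simpa [truth] using ha.1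
    | top =>
      rw [show Term.realize x (Term.func (L := lang) Func.top ts) = ⊤ from H.top _]
      simp [truth]
    | compl =>
      rw [show Term.realize x (Term.func (L := lang) Func.compl ts) =
        (Term.realize x (ts 0))ᶜ from H.compl _, IsAtom.le_compl_iff ha, ih]
      simp [truth]
    | inf =>
      rw [show Term.realize x (Term.func (L := lang) Func.inf ts) =
        Term.realize x (ts 0) ⊓ Term.realize x (ts 1) from H.inf _, le_inf_iff, ih, ih]
      simp [truth]
    | sup =>
      rw [show Term.realize x (Term.func (L := lang) Func.sup ts) =
        Term.realize x (ts 0) ⊔ Term.realize x (ts 1) from H.sup _, (supPrime_of_isAtom ha).le_sup, ih, ih]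
      simp [truth]

end Minterm

/-! ### Tuples with similar minterms. -/

section Tuples

variable {A B : Type*} [BooleanAlgebra A] [lang.Structure A] [BooleanAlgebra B] [lang.Structure B]

/-- If `b ≤ c` fails, atomicity provides an atom below `b \ c`. -/
theorem IsPresburgerAlgebra.ext_atoms (H : IsPresburgerAlgebra B) {b c : B}
    (h : ∀ a, IsAtom a → (a ≤ b ↔ a ≤ c)) : b = c := by
  have key {b c : B} (h : ∀ a, IsAtom a → a ≤ b → a ≤ c) : b ≤ c := by
    by_contra hbc
    obtain ⟨a, ha, hab⟩ := H.exists_atom (b \ c) (by rwa [Ne, sdiff_eq_bot_iff])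
    rw [sdiff_eq, le_inf_iff, IsAtom.le_compl_iff ha] at hab
    exact hab.2 (h a ha hab.1)
  exact le_antisymm (key fun a ha => (h a ha).1) (key fun a ha => (h a ha).2)

-- Disjunctive normal form, checked on atoms.
open Classical in
theorem IsPresburgerAlgebra.realize_eq_sup (H : IsPresburgerAlgebra B) {ι : Type} [Fintype ι]
    (x : ι → B) (t : lang.Term ι) :
    t.realize x = (Finset.univ.filter fun p => truth p t = true).sup (minterm x) := by
  refine H.ext_atoms fun a ha => ?_
  rw [H.le_realize_iff ha, IsAtom.le_sup_minterm_iff ha]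
  simp

/-- The minterms of two tuples are pairwise similar. -/
def TupleSimilar (N : ℕ) (M : ℕ+) {ι : Type} [Fintype ι] (x : ι → A) (y : ι → B) : Prop :=
  ∀ p, Similar N M (minterm x p) (minterm y p)

variable (HA : IsPresburgerAlgebra A) (HB : IsPresburgerAlgebra B) {N : ℕ} {M : ℕ+}
include HA HB

theorem TupleSimilar.sup {ι : Type} [Fintype ι] {x : ι → A} {y : ι → B}
    (h : TupleSimilar N M x y) (s : Finset (ι → Bool)) :
    Similar N M (s.sup (minterm x)) (s.sup (minterm y)) := by
  classical
  induction s using Finset.induction_on with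
  | empty => exact similar_bot HA HB
  | insert p s hp ih =>
    rw [Finset.sup_insert, Finset.sup_insert]
    refine (h p).sup HA HB ih ?_ ?_ <;> rw [← disjoint_iff, Finset.disjoint_sup_right] <;>
      exact fun q hq => disjoint_minterm fun e => hp (e ▸ hq)

theorem TupleSimilar.realize {ι : Type} [Fintype ι] {x : ι → A} {y : ι → B}
    (h : TupleSimilar N M x y) (t : lang.Term ι) : Similar N M (t.realize x) (t.realize y) := by
  rw [HA.realize_eq_sup, HB.realize_eq_sup]
  exact h.sup HA HB _

/-- Each minterm is split separately by `Similar.exists_split`, and `b` is the join of the pieces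
chosen inside the minterms of the second tuple. -/
theorem TupleSimilar.exists_snoc {α : Type} [Fintype α] {k : ℕ} {v : α → A} {xs : Fin k → A}
    {w : α → B} {ys : Fin k → B}
    (h : TupleSimilar (2 * N + M) M (Sum.elim v xs) (Sum.elim w ys)) (a : A) :
    ∃ b : B, TupleSimilar N M (Sum.elim v (Fin.snoc xs a : Fin (k + 1) → A))
      (Sum.elim w (Fin.snoc ys b : Fin (k + 1) → B)) := by
  classical
  choose f hf hs hs' using fun p => (h p).exists_split HA HB
    (inf_le_left : minterm (Sum.elim v xs) p ⊓ a ≤ _)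
  -- Minterms are disjoint, so the join of all pieces meets each minterm in its own piece only.
  have key (p) : minterm (Sum.elim w ys) p ⊓ Finset.univ.sup f = f p := by
    refine le_antisymm ?_ (le_inf (hf p) (Finset.le_sup (Finset.mem_univ p)))
    rw [Finset.sup_inf_distrib_left]
    refine Finset.sup_le fun q _ => ?_
    by_cases hpq : p = q
    · subst hpq; exact inf_le_right
    · rw [((disjoint_minterm hpq).mono_right (hf q)).eq_bot]
      exact bot_le
  refine ⟨Finset.univ.sup f, fun q => ?_⟩
  rw [minterm_snoc, minterm_snoc]
  cases q (Sum.inr (Fin.last k))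
  · have := hs' (q ∘ Sum.map id Fin.castSucc)
    rw [sdiff_inf_self_left, ← key, sdiff_inf_self_left, sdiff_eq, sdiff_eq] at this
    simpa using this
  · have := hs (q ∘ Sum.map id Fin.castSucc)
    rw [← key] at this
    simpa using this

end Tuples

/-! ### Back and forth through formulas. -/

section BackAndForth

variable {α : Type}

/-- How far `C_n` has to agree for tuples to agree on a formula, if all moduli of the formula
divide `M`. -/
def rank (M : ℕ+) : ∀ {k : ℕ}, Fm α k → ℕ
  | _, .falsum => 0
  | _, .equal _ _ => 1
  | _, .rel (l := 1) (Rel.C n) _ => n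
  | _, .rel (l := 1) Rel.fin _ => 0
  | _, .rel (l := 1) (Rel.res _ _) _ => 0
  | _, .imp φ ψ => max (rank M φ) (rank M ψ)
  | _, .all φ => 2 * rank M φ + M

/-- All moduli in a formula divide `M`. -/
def ModuliDvd (M : ℕ+) : ∀ {k : ℕ}, Fm α k → Prop
  | _, .falsum => True
  | _, .equal _ _ => True
  | _, .rel (l := 1) (Rel.C _) _ => True
  | _, .rel (l := 1) Rel.fin _ => True
  | _, .rel (l := 1) (Rel.res n _) _ => (n : ℕ) ∣ M
  | _, .imp φ ψ => ModuliDvd M φ ∧ ModuliDvd M ψ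
  | _, .all φ => ModuliDvd M φ

theorem ModuliDvd.mono {M M' : ℕ+} (hM : (M : ℕ) ∣ M') {k : ℕ} {φ : Fm α k}
    (h : ModuliDvd M φ) : ModuliDvd M' φ := by
  induction φ with
  | falsum => trivial
  | equal => trivial
  | rel R ts =>
    cases R with
    | C => trivial
    | fin => trivial
    | res n r => exact Nat.dvd_trans h hM
  | imp φ ψ ih1 ih2 => exact ⟨ih1 h.1, ih2 h.2⟩
  | all φ ih => exact ih h

theorem exists_moduliDvd {k : ℕ} (φ : Fm α k) : ∃ M : ℕ+, ModuliDvd M φ := by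
  induction φ with
  | falsum => exact ⟨1, trivial⟩
  | equal => exact ⟨1, trivial⟩
  | rel R ts =>
    cases R with
    | C => exact ⟨1, trivial⟩
    | fin => exact ⟨1, trivial⟩
    | res n r => exact ⟨n, dvd_rfl⟩
  | imp φ ψ ih1 ih2 =>
    obtain ⟨M, h⟩ := ih1
    obtain ⟨M', h'⟩ := ih2
    exact ⟨M * M', h.mono (by simp), h'.mono (by simp)⟩
  | all φ ih => exact ih

section

variable {B : Type*} [lang.Structure B] {k : ℕ} (v : α → B) (xs : Fin k → B) (ts : Fin 1 → Tm α k)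

theorem realize_rel_C (n : ℕ+) :
    (BoundedFormula.rel (L := lang) (Rel.C n) ts : Fm α k).Realize v xs ↔
      HasC n ((ts 0).realize (Sum.elim v xs)) := by
  rw [← realize_fC, fC]
  rw [show ![ts 0] = ts from funext fun i => by fin_cases i; rfl]

theorem realize_rel_fin :
    (BoundedFormula.rel (L := lang) Rel.fin ts : Fm α k).Realize v xs ↔
      IsFin ((ts 0).realize (Sum.elim v xs)) := by
  rw [← realize_fFin, fFin]
  rw [show ![ts 0] = ts from funext fun i => by fin_cases i; rfl]

theorem realize_rel_res (n : ℕ+) (r : ℤ) :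
    (BoundedFormula.rel (L := lang) (Rel.res n r) ts : Fm α k).Realize v xs ↔
      HasRes n r ((ts 0).realize (Sum.elim v xs)) := by
  rw [← realize_fRes, fRes]
  rw [show ![ts 0] = ts from funext fun i => by fin_cases i; rfl]

end

/-- A residue modulo `M` determines those modulo all divisors of `M`, so one modulus serves for a
whole formula. -/
theorem IsPresburgerAlgebra.res_iff_of_dvd {B : Type*} [BooleanAlgebra B] [lang.Structure B]
    (H : IsPresburgerAlgebra B) {n M : ℕ+} {r : ℤ} {b : B} (hM : (n : ℕ) ∣ M) :
    HasRes n r b ↔ ∃ s, HasRes M s b ∧ s ≡ r [ZMOD (n : ℤ)] := by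
  constructor
  · intro h
    obtain ⟨s, -, hs⟩ := H.exists_res M b (H.fin_of_res _ _ _ h)
    exact ⟨s, hs, H.res_unique n _ _ b (H.res_dvd n M s b hM hs) h⟩
  · rintro ⟨s, hs, h⟩
    exact H.res_congr n s r b h (H.res_dvd n M s b hM hs)

variable [Fintype α] {A B : Type*} [BooleanAlgebra A] [lang.Structure A] [BooleanAlgebra B]
  [lang.Structure B] (HA : IsPresburgerAlgebra A) (HB : IsPresburgerAlgebra B) {M : ℕ+}
include HA HB

/-- Two values are equal iff their symmetric difference has no atom, which is why equations have
`rank` one. -/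
theorem TupleSimilar.realize_eq_iff {k : ℕ} {v : α → A} {xs : Fin k → A} {w : α → B}
    {ys : Fin k → B} (h : TupleSimilar 1 M (Sum.elim v xs) (Sum.elim w ys)) (s t : Tm α k) :
    s.realize (Sum.elim v xs) = t.realize (Sum.elim v xs) ↔
      s.realize (Sum.elim w ys) = t.realize (Sum.elim w ys) := by
  have h1 := (h.realize HA HB
    (tSup (tInf s (tCompl t)) (tInf t (tCompl s)))).count 1 le_rfl
  simp only [Nat.cast_one, Order.one_le_iff_ne_zero, Ne, HA.atomCount_eq_zero_iff,
    HB.atomCount_eq_zero_iff, not_iff_not] at h1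
  rw [realize_tSup HA.toOpsAgree, realize_tSup HB.toOpsAgree] at h1
  simp only [realize_tInf HA.toOpsAgree, realize_tInf HB.toOpsAgree,
    realize_tCompl HA.toOpsAgree, realize_tCompl HB.toOpsAgree, ← sdiff_eq] at h1
  rwa [← symmDiff_def, ← symmDiff_def, symmDiff_eq_bot, symmDiff_eq_bot] at h1

/-- Tuples with similar minterms satisfy the same formulas of bounded rank. -/
theorem TupleSimilar.realize_iff {k : ℕ} {φ : Fm α k} (hφ : ModuliDvd M φ)
    {v : α → A} {xs : Fin k → A} {w : α → B} {ys : Fin k → B}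
    (h : TupleSimilar (rank M φ) M (Sum.elim v xs) (Sum.elim w ys)) :
    φ.Realize v xs ↔ φ.Realize w ys := by
  induction φ with
  | falsum => rfl
  | equal s t => exact h.realize_eq_iff HA HB s t
  | rel R ts =>
    cases R with
    | C n =>
      rw [realize_rel_C, realize_rel_C, HA.hasC_iff, HB.hasC_iff]
      exact (h.realize HA HB (ts 0)).count n le_rfl
    | fin =>
      rw [realize_rel_fin, realize_rel_fin]
      exact (h.realize HA HB (ts 0)).fin
    | res n r =>
      rw [realize_rel_res, realize_rel_res, HA.res_iff_of_dvd hφ, HB.res_iff_of_dvd hφ]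
      simp only [(h.realize HA HB (ts 0)).res]
  | imp φ ψ ih1 ih2 =>
    exact imp_congr (ih1 hφ.1 fun p => (h p).mono (le_max_left _ _))
      (ih2 hφ.2 fun p => (h p).mono (le_max_right _ _))
  | all φ ih =>
    -- The `rank` of a quantified formula is chosen so that `exists_snoc` leaves similarity at the
    -- `rank` of its body; the symmetry of similarity gives the other direction.
    constructor
    · intro hx b
      obtain ⟨a, ha⟩ := TupleSimilar.exists_snoc HB HA (fun p => (h p).symm) b
      exact (ih hφ fun p => (ha p).symm).1 (hx a)
    · intro hy a
      obtain ⟨b, hb⟩ := h.exists_snoc HA HB a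
      exact (ih hφ hb).2 (hy b)

end BackAndForth

/-! ### Completeness. -/

section Complete

/-- The empty tuple has `⊤` as its only minterm. It is outside `Fin` in both models, hence similar
at every level. -/
theorem realize_sentence_iff {A B : Type*} [lang.Structure A] [lang.Structure B] (hA : A ⊨ T₃)
    (hB : B ⊨ T₃) (φ : lang.Sentence) : A ⊨ φ ↔ B ⊨ φ := by
  obtain ⟨_, HA⟩ := exists_isPresburgerAlgebra hA
  obtain ⟨_, HB⟩ := exists_isPresburgerAlgebra hB
  obtain ⟨M, hM⟩ := exists_moduliDvd φ
  refine TupleSimilar.realize_iff HA HB hM fun p => ?_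
  have hA (x : Empty ⊕ Fin 0 → A) : minterm x p = ⊤ := by simp [minterm]
  have hB (x : Empty ⊕ Fin 0 → B) : minterm x p = ⊤ := by simp [minterm]
  rw [hA, hB]
  exact similar_of_not_fin HA HB HA.not_fin_top HB.not_fin_top

theorem set_model (I : Type*) [Infinite I] : Set I ⊨ T₃ := (isPresburgerAlgebra_set I).model

theorem models_T₃_iff (φ : lang.Sentence) : T₃ ⊨ᵇ φ ↔ Set ℕ ⊨ φ := by
  rw [Theory.models_sentence_iff]
  constructor
  · intro h
    have := set_model ℕ
    exact h (Theory.ModelType.of T₃ (Set ℕ))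
  · intro h A
    exact (realize_sentence_iff (set_model ℕ) A.is_model φ).1 h

theorem T₃_isComplete : T₃.IsComplete := by
  refine ⟨⟨@Theory.ModelType.of _ T₃ (Set ℕ) _ (set_model ℕ) _⟩, fun φ => ?_⟩
  rw [models_T₃_iff, models_T₃_iff, Sentence.realize_not]
  exact em _

end Complete

/-! ### Quantifier elimination. -/

section QuantifierElimination

theorem isQF_foldr_sup {L : FirstOrder.Language} {α : Type*} {n : ℕ}
    (l : List (L.BoundedFormula α n)) (h : ∀ φ ∈ l, φ.IsQF) : (l.foldr (· ⊔ ·) ⊥).IsQF := by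
  induction l with
  | nil => exact BoundedFormula.isQF_bot
  | cons φ l ih =>
    exact (h φ (by simp)).sup (ih fun ψ hψ => h ψ (by simp [hψ]))

theorem isQF_foldr_inf {L : FirstOrder.Language} {α : Type*} {n : ℕ}
    (l : List (L.BoundedFormula α n)) (h : ∀ φ ∈ l, φ.IsQF) : (l.foldr (· ⊓ ·) ⊤).IsQF := by
  induction l with
  | nil => exact BoundedFormula.IsQF.top
  | cons φ l ih =>
    exact (h φ (by simp)).inf (ih fun ψ hψ => h ψ (by simp [hψ]))

theorem isQF_iSup {L : FirstOrder.Language} {α β : Type*} [Finite β] {n : ℕ}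
    {f : β → L.BoundedFormula α n} (h : ∀ b, (f b).IsQF) : (BoundedFormula.iSup f).IsQF :=
  isQF_foldr_sup _ fun φ hφ => by
    obtain ⟨b, -, rfl⟩ := List.mem_map.1 hφ
    exact h b

theorem isQF_iInf {L : FirstOrder.Language} {α β : Type*} [Finite β] {n : ℕ}
    {f : β → L.BoundedFormula α n} (h : ∀ b, (f b).IsQF) : (BoundedFormula.iInf f).IsQF :=
  isQF_foldr_inf _ fun φ hφ => by
    obtain ⟨b, -, rfl⟩ := List.mem_map.1 hφ
    exact h b

variable {α : Type} [Fintype α] {k : ℕ}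

/-- A term for the minterm with a given pattern. -/
noncomputable def mintermTerm (p : α ⊕ Fin k → Bool) : Tm α k :=
  (Finset.univ : Finset (α ⊕ Fin k)).toList.foldr
    (fun i t => tInf (if p i then Term.var i else tCompl (Term.var i)) t) tTop

theorem realize_mintermTerm {B : Type*} [BooleanAlgebra B] [lang.Structure B] (H : OpsAgree B)
    (p : α ⊕ Fin k → Bool) (v : α → B) (xs : Fin k → B) :
    (mintermTerm p).realize (Sum.elim v xs) = minterm (Sum.elim v xs) p := by
  have key (l : List (α ⊕ Fin k)) (b : B) :
      b ≤ Term.realize (Sum.elim v xs) (l.foldr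
        (fun i t => tInf (if p i then Term.var i else tCompl (Term.var i)) t) (tTop : Tm α k)) ↔
      ∀ i ∈ l, b ≤ if p i then Sum.elim v xs i else (Sum.elim v xs i)ᶜ := by
    induction l with
    | nil => simp [realize_tTop H]
    | cons i l ih =>
      rw [List.foldr_cons, realize_tInf H, le_inf_iff, ih, List.forall_mem_cons]
      refine and_congr_left fun _ => ?_
      cases p i <;> simp [realize_tCompl H]
  refine eq_of_forall_le_iff fun b => ?_
  rw [mintermTerm, key, le_minterm]
  simp

/-- Basic statements about minterms. -/
noncomputable def basicFormula (N : ℕ) (M : ℕ+) :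
    (α ⊕ Fin k → Bool) × (Fin N ⊕ Unit ⊕ Fin M) → Fm α k
  | (p, .inl i) => fC (i : ℕ).succPNat (mintermTerm p)
  | (p, .inr (.inl _)) => fFin (mintermTerm p)
  | (p, .inr (.inr r)) => fRes M (r : ℕ) (mintermTerm p)

theorem isQF_basicFormula (N : ℕ) (M : ℕ+) (f) : (basicFormula (α := α) (k := k) N M f).IsQF := by
  rcases f with ⟨p, i | u | r⟩ <;> exact (BoundedFormula.IsAtomic.rel _ _).isQF

theorem tupleSimilar_of_basicFormula {A B : Type*} [BooleanAlgebra A] [lang.Structure A]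
    [BooleanAlgebra B] [lang.Structure B] (HA : IsPresburgerAlgebra A)
    (HB : IsPresburgerAlgebra B) {N : ℕ} {M : ℕ+} {v : α → A} {xs : Fin k → A} {w : α → B}
    {ys : Fin k → B}
    (h : ∀ f, (basicFormula N M f).Realize v xs ↔ (basicFormula N M f).Realize w ys) :
    TupleSimilar N M (Sum.elim v xs) (Sum.elim w ys) := by
  refine fun p => ⟨fun n hn => ?_, ?_, fun r => ?_⟩
  · cases n with
    | zero => simp
    | succ n =>
      have := h (p, .inl ⟨n, hn⟩)
      simpa only [basicFormula, realize_fC, Nat.succPNat_coe, HA.hasC_iff, HB.hasC_iff,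
        realize_mintermTerm HA.toOpsAgree, realize_mintermTerm HB.toOpsAgree] using this
  · simpa only [basicFormula, realize_fFin, realize_mintermTerm HA.toOpsAgree,
      realize_mintermTerm HB.toOpsAgree] using h (p, .inr (.inl ()))
  -- The basic formulas mention only residues in `[0, M)`, so an arbitrary integer `r` is first
  -- reduced modulo `M`.
  · have hM : (0 : ℤ) < M := by exact_mod_cast M.pos
    obtain ⟨s, hs⟩ := Int.eq_ofNat_of_zero_le (Int.emod_nonneg r hM.ne')
    have hsM : s < M := by
      zify
      exact (show (s : ℤ) = r % M from hs.symm) ▸ Int.emod_lt_of_pos r hM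
    have hrs : r ≡ s [ZMOD (M : ℤ)] :=
      (show (s : ℤ) = r % M from hs.symm) ▸ (Int.mod_modEq r M).symm
    rw [HA.res_congr_iff hrs, HB.res_congr_iff hrs]
    simpa only [basicFormula, realize_fRes, realize_mintermTerm HA.toOpsAgree,
      realize_mintermTerm HB.toOpsAgree] using h (p, .inr (.inr ⟨s, hsM⟩))

/-- There are finitely many basic formulas, and the truth values of all of them at a tuple decide
`φ`, whatever the model. So `ψ` is the disjunction over those assignments of truth values that occur
together with `φ` in some model. -/
theorem exists_isQF_of_fintype (φ : Fm α k) : ∃ ψ : Fm α k, ψ.IsQF ∧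
    ∀ (B : Type) [lang.Structure B], B ⊨ T₃ → ∀ (v : α → B) (xs : Fin k → B),
      φ.Realize v xs ↔ ψ.Realize v xs := by
  classical
  obtain ⟨M, hM⟩ := exists_moduliDvd φ
  let θ := basicFormula (α := α) (k := k) (rank M φ) M
  let S := {b : (α ⊕ Fin k → Bool) × (Fin (rank M φ) ⊕ Unit ⊕ Fin M) → Bool //
    ∃ (B : Type) (_ : lang.Structure B) (_ : B ⊨ T₃) (v : α → B) (xs : Fin k → B),
      φ.Realize v xs ∧ ∀ f, (θ f).Realize v xs ↔ b f = true}
  refine ⟨BoundedFormula.iSup fun b : S => BoundedFormula.iInf fun f =>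
    if b.1 f then θ f else ∼(θ f), isQF_iSup fun b => isQF_iInf fun f => ?_, ?_⟩
  · split_ifs
    · exact isQF_basicFormula _ _ f
    · exact (isQF_basicFormula _ _ f).not
  · intro B _ hB v xs
    have key (b : S) (f) : (if b.1 f then θ f else ∼(θ f)).Realize v xs ↔
        ((θ f).Realize v xs ↔ b.1 f = true) := by
      cases b.1 f <;> simp
    simp only [BoundedFormula.realize_iSup, BoundedFormula.realize_iInf, key]
    constructor
    · intro h
      exact ⟨⟨fun f => decide ((θ f).Realize v xs), B, _, hB, v, xs, h, fun f => by simp⟩,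
        fun f => by simp⟩
    · rintro ⟨⟨b, A, _, hA, w, ys, h, hb⟩, hf⟩
      obtain ⟨_, HA⟩ := exists_isPresburgerAlgebra hA
      obtain ⟨_, HB⟩ := exists_isPresburgerAlgebra hB
      exact (TupleSimilar.realize_iff HA HB hM
        (tupleSimilar_of_basicFormula HA HB fun f => (hb f).trans (hf f).symm)).1 h

theorem T₃_hasQE : HasQE T₃ := by
  classical
  intro α φ
  -- The type `α` may be infinite, so `φ` is first restricted to its finitely many free variables.
  obtain ⟨ψ, hψ, h⟩ := exists_isQF_of_fintype (BoundedFormula.restrictFreeVar φ id)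
  refine ⟨Formula.relabel (Subtype.val : φ.freeVarFinset → α) ψ, hψ.relabel _, ?_⟩
  intro B v xs
  rw [BoundedFormula.realize_iff, Subsingleton.elim xs default]
  change Formula.Realize φ v ↔ Formula.Realize _ v
  rw [Formula.realize_relabel, Formula.Realize, Formula.Realize, ← h B B.is_model,
    BoundedFormula.realize_restrictFreeVar (v' := v)]
  simp

end QuantifierElimination

/-! ### Primitive recursion on lists and course-of-values recursion. -/

section Primrec

variable {α β σ : Type*} [Primcodable α] [Primcodable β] [Primcodable σ]

theorem primrec_ite_eq {c : α → ℕ} (hc : Primrec c) (n : ℕ) {f g : α → σ} (hf : Primrec f)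
    (hg : Primrec g) : Primrec fun a => if c a = n then f a else g a :=
  Primrec.ite (Primrec.eq.comp hc (Primrec.const n)) hf hg

theorem primrec_filter {f : α → List β} {p : α → β → Bool} (hf : Primrec f) (hp : Primrec₂ p) :
    Primrec fun a => (f a).filter (p a) := by
  have : Primrec₂ fun (a : α) (b : β) => cond (p a b) (some b) none :=
    Primrec.cond hp (Primrec.option_some.comp Primrec.snd) (Primrec.const none)
  refine (Primrec.listFilterMap hf this).of_eq fun a => ?_
  induction f a with
  | nil => rfl
  | cons b l ih => cases h : p a b <;> simp [h, ih]

theorem primrec_all {f : α → List β} {p : α → β → Bool} (hf : Primrec f) (hp : Primrec₂ p) :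
    Primrec fun a => (f a).all (p a) := by
  have : Primrec₂ fun (a : α) (b : β × Bool) => p a b.1 && b.2 :=
    Primrec.and.comp (hp.comp Primrec.fst (Primrec.fst.comp Primrec.snd))
      (Primrec.snd.comp Primrec.snd)
  refine (Primrec.list_foldr hf (Primrec.const true) this).of_eq fun a => ?_
  induction f a with
  | nil => rfl
  | cons b l ih => simp [ih]

/-- Membership in a list, as a Boolean. -/
def isMem [DecidableEq β] (b : β) (l : List β) : Bool := !l.all fun c => !decide (c = b)

omit [Primcodable β] in
theorem isMem_iff [DecidableEq β] {b : β} {l : List β} : isMem b l = true ↔ b ∈ l := by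
  simp [isMem]

theorem primrec_isMem [DecidableEq β] : Primrec₂ (isMem (β := β)) := by
  have h : Primrec₂ fun (a : β × List β) (b : β) => !decide (b = a.1) :=
    Primrec.not.comp (Primrec.eq.decide.comp Primrec.snd (Primrec.fst.comp Primrec.fst))
  exact Primrec.not.comp (primrec_all Primrec.snd h)

/-- The list of the first `n` values of the function `a ↦ n ↦ G a l`, where `l` is the list of the
values at smaller arguments. -/
def valueTable (G : α → List σ → σ) (a : α) : ℕ → List σ
  | 0 => []
  | n + 1 => valueTable G a n ++ [G a (valueTable G a n)]

/-- Course-of-values recursion. -/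
def courseRec (G : α → List σ → σ) (a : α) (n : ℕ) : σ := G a (valueTable G a n)

omit [Primcodable α] [Primcodable σ] in
theorem length_valueTable (G : α → List σ → σ) (a : α) (n : ℕ) :
    (valueTable G a n).length = n := by
  induction n with
  | zero => rfl
  | succ n ih => simp [valueTable, ih]

omit [Primcodable α] [Primcodable σ] in
theorem getD_valueTable (G : α → List σ → σ) (a : α) (d : σ) {n i : ℕ} (h : i < n) :
    (valueTable G a n).getD i d = courseRec G a i := by
  induction n with
  | zero => omega
  | succ n ih =>
    rw [valueTable]
    rcases Nat.lt_succ_iff_lt_or_eq.1 h with h | rfl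
    · rw [List.getD_append _ _ _ _ (by rwa [length_valueTable]), ih h]
    · rw [List.getD_append_right _ _ _ _ (by rw [length_valueTable]), length_valueTable]
      simp [courseRec]

theorem primrec_courseRec {G : α → List σ → σ} (hG : Primrec₂ G) : Primrec₂ (courseRec G) := by
  have h1 : Primrec₂ fun (a : α) (p : ℕ × List σ) => p.2 ++ [G a p.2] :=
    Primrec.list_concat.comp (Primrec.snd.comp Primrec.snd)
      (hG.comp Primrec.fst (Primrec.snd.comp Primrec.snd))
  have h2 : Primrec₂ (valueTable G) := by
    refine (Primrec.nat_rec (Primrec.const []) h1).of_eq fun a n => ?_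
    induction n with
    | zero => rfl
    | succ n ih =>
      simp only [valueTable] at ih ⊢
      rw [← ih]
  exact hG.comp Primrec.fst h2

end Primrec

/-! ### Evaluation and recognition of term codes. -/

section Terms

/-- The recursion step of `termValue`. -/
def termValueStep (v : List Bool) (l : List Bool) : Bool :=
  -- The table `l` holds the values at all smaller codes, so its length is the current code. All
  -- recursion steps below use this convention.
  if l.length.unpair.1 = 0 then v.getD l.length.unpair.2 false
  else if l.length.unpair.1 = 1 then false
  else if l.length.unpair.1 = 2 then true
  else if l.length.unpair.1 = 3 then !l.getD l.length.unpair.2 false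
  else if l.length.unpair.1 = 4 then
    l.getD l.length.unpair.2.unpair.1 false && l.getD l.length.unpair.2.unpair.2 false
  else l.getD l.length.unpair.2.unpair.1 false || l.getD l.length.unpair.2.unpair.2 false

/-- The value of the term with a given code at a pattern. -/
def termValue : List Bool → ℕ → Bool := courseRec termValueStep

/-- The recursion step of `isTermCode`. -/
def isTermCodeStep (k : ℕ) (l : List Bool) : Bool :=
  if l.length.unpair.1 = 0 then decide (l.length.unpair.2 < k)
  else if l.length.unpair.1 = 1 then decide (l.length.unpair.2 = 0)
  else if l.length.unpair.1 = 2 then decide (l.length.unpair.2 = 0)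
  else if l.length.unpair.1 = 3 then l.getD l.length.unpair.2 false
  else if l.length.unpair.1 = 4 then
    l.getD l.length.unpair.2.unpair.1 false && l.getD l.length.unpair.2.unpair.2 false
  else if l.length.unpair.1 = 5 then
    l.getD l.length.unpair.2.unpair.1 false && l.getD l.length.unpair.2.unpair.2 false
  else false

/-- A number is the code of a term with `k` variables. -/
def isTermCode : ℕ → ℕ → Bool := courseRec isTermCodeStep

open Primrec in
theorem primrec_termValue : Primrec₂ termValue := by
  have hn : Primrec fun p : List Bool × List Bool => p.2.length.unpair :=
    unpair.comp (list_length.comp snd)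
  have h1 := fst.comp hn
  have h2 := snd.comp hn
  have h21 := fst.comp (unpair.comp h2)
  have h22 := snd.comp (unpair.comp h2)
  exact primrec_courseRec <| primrec_ite_eq h1 0 ((list_getD false).comp fst h2) <|
    primrec_ite_eq h1 1 (const false) <| primrec_ite_eq h1 2 (const true) <|
    primrec_ite_eq h1 3 (Primrec.not.comp ((list_getD false).comp snd h2)) <|
    primrec_ite_eq h1 4
      (Primrec.and.comp ((list_getD false).comp snd h21) ((list_getD false).comp snd h22))
      (Primrec.or.comp ((list_getD false).comp snd h21) ((list_getD false).comp snd h22))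

open Primrec in
theorem primrec_isTermCode : Primrec₂ isTermCode := by
  have hn : Primrec fun p : ℕ × List Bool => p.2.length.unpair :=
    unpair.comp (list_length.comp snd)
  have h1 := fst.comp hn
  have h2 := snd.comp hn
  have h21 := fst.comp (unpair.comp h2)
  have h22 := snd.comp (unpair.comp h2)
  have h0 := Primrec.eq.decide.comp h2 (const 0)
  have ha := Primrec.and.comp ((list_getD false).comp snd h21) ((list_getD false).comp snd h22)
  exact primrec_courseRec <| primrec_ite_eq h1 0 (nat_lt.decide.comp h2 fst) <|
    primrec_ite_eq h1 1 h0 <| primrec_ite_eq h1 2 h0 <|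
    primrec_ite_eq h1 3 ((list_getD false).comp snd h2) <|
    primrec_ite_eq h1 4 ha <| primrec_ite_eq h1 5 ha (const false)

end Terms

/-! ### Recognition and evaluation of formula codes. -/

section Formulas

/-- The condition of `formulaLevels` for the level `k`. -/
def isFormulaCodeAt (l : List (List ℕ)) (k : ℕ) : Bool :=
  if l.length.unpair.1 = 0 then decide (l.length.unpair.2 = 0)
  else if l.length.unpair.1 = 1 then
    isTermCode k l.length.unpair.2.unpair.1 && isTermCode k l.length.unpair.2.unpair.2
  else if l.length.unpair.1 = 2 then
    decide (0 < l.length.unpair.2.unpair.1) && isTermCode k l.length.unpair.2.unpair.2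
  else if l.length.unpair.1 = 3 then isTermCode k l.length.unpair.2
  else if l.length.unpair.1 = 4 then
    decide (0 < l.length.unpair.2.unpair.1) && isTermCode k l.length.unpair.2.unpair.2.unpair.2
  else if l.length.unpair.1 = 5 then
    isMem k (l.getD l.length.unpair.2.unpair.1 []) &&
      isMem k (l.getD l.length.unpair.2.unpair.2 [])
  -- The body of a quantified formula lives one level higher, so the table has to record all levels
  -- of a code and not a single one.
  else if l.length.unpair.1 = 6 then isMem (k + 1) (l.getD l.length.unpair.2 [])
  else false

/-- The numbers `k ≤ e` such that the given number is the code of a formula with `k` variables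
in scope, provided that the sum of both numbers is at most `e`. -/
def formulaLevels : ℕ → ℕ → List ℕ :=
  courseRec fun e l => (List.range (e + 1)).filter (isFormulaCodeAt l)

open Primrec in
theorem primrec_formulaLevels : Primrec₂ formulaLevels := by
  have hn : Primrec fun p : List (List ℕ) × ℕ => p.1.length.unpair :=
    unpair.comp (list_length.comp fst)
  have h1 := fst.comp hn
  have h2 := snd.comp hn
  have h21 := fst.comp (unpair.comp h2)
  have h22 := snd.comp (unpair.comp h2)
  have h222 := snd.comp (unpair.comp h22)
  have hp := nat_lt.decide.comp (const 0) h21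
  have hw : Primrec₂ isFormulaCodeAt :=
    primrec_ite_eq h1 0 (Primrec.eq.decide.comp h2 (const 0)) <|
    primrec_ite_eq h1 1 (Primrec.and.comp (primrec_isTermCode.comp snd h21)
      (primrec_isTermCode.comp snd h22)) <|
    primrec_ite_eq h1 2 (Primrec.and.comp hp (primrec_isTermCode.comp snd h22)) <|
    primrec_ite_eq h1 3 (primrec_isTermCode.comp snd h2) <|
    primrec_ite_eq h1 4 (Primrec.and.comp hp (primrec_isTermCode.comp snd h222)) <|
    primrec_ite_eq h1 5 (Primrec.and.comp
      (primrec_isMem.comp snd ((list_getD []).comp fst h21))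
      (primrec_isMem.comp snd ((list_getD []).comp fst h22))) <|
    primrec_ite_eq h1 6 (primrec_isMem.comp (succ.comp snd) ((list_getD []).comp fst h2))
      (const false)
  exact primrec_courseRec <| primrec_filter (list_range.comp (succ.comp fst))
    (hw.comp (snd.comp fst) snd)

/-- A list of patterns, each with the number of atoms of the corresponding minterm, where `none`
stands for infinity. -/
abbrev Env : Type := List (List Bool × Option ℕ)

/-- Addition of cardinalities. -/
def addCount (a b : Option ℕ) : Option ℕ := a.bind fun m => b.map fun n => m + n

/-- The total number of atoms. -/
def Env.total (E : Env) : Option ℕ := E.foldr (fun m n => addCount m.2 n) (some 0)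

/-- The number of atoms below the value of the term with a given code. -/
def Env.count (E : Env) (c : ℕ) : Option ℕ := Env.total (E.filter fun m => termValue m.1 c)

/-- The ways to split a set of given cardinality in two, with bounded finite parts if the set is
infinite. -/
def splitCount (b : ℕ) : Option ℕ → List (Option ℕ × Option ℕ)
  | none => (none, none) :: ((List.range b).map (fun n => (some n, none)) ++
      (List.range b).map (fun n => (none, some n)))
  | some c => (List.range (c + 1)).map fun n => (some n, some (c - n))

/-- The environments that arise by adding one element to a tuple. -/
def Env.splits (b : ℕ) (E : Env) : List Env :=
  E.foldr (fun m Es => (splitCount b m.2).flatMap fun c =>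
    Es.map fun E' => (m.1 ++ [true], c.1) :: (m.1 ++ [false], c.2) :: E') [ [] ]

/-- All environments that arise by adding at most `j` elements to the empty tuple. -/
def envs (b : ℕ) : ℕ → List Env
  | 0 => [ [([], none)] ]
  | j + 1 => envs b j ++ (envs b j).flatMap (Env.splits b)

/-- A number is at most a cardinality. -/
def leCount (n : ℕ) : Option ℕ → Bool
  | none => true
  | some m => decide (n ≤ m)

/-- A cardinality is finite and congruent modulo `n` to the integer with code `r`. -/
def resCount (n r : ℕ) : Option ℕ → Bool
  | none => false
  -- The code `2 * j` stands for `j` and `2 * j + 1` for `-(j + 1)`; in the second case the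
  -- congruence says that `n` divides `m + j + 1`.
  | some m => if r % 2 = 0 then decide (m % n = r / 2 % n) else decide ((m + r / 2 + 1) % n = 0)

/-- The truth of a formula in an environment, given the lists of the environments in which the
formulas with smaller codes are true. -/
def isTrueAt (b : ℕ) (l : List (List Env)) (E : Env) : Bool :=
  if l.length.unpair.1 = 0 then false
  else if l.length.unpair.1 = 1 then
    -- An equation holds iff both terms have the same value at every pattern whose cell is nonempty.
    E.all fun m => decide (m.2 = some 0) || decide (termValue m.1 l.length.unpair.2.unpair.1 =
      termValue m.1 l.length.unpair.2.unpair.2)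
  else if l.length.unpair.1 = 2 then
    leCount l.length.unpair.2.unpair.1 (E.count l.length.unpair.2.unpair.2)
  else if l.length.unpair.1 = 3 then (E.count l.length.unpair.2).isSome
  else if l.length.unpair.1 = 4 then
    resCount l.length.unpair.2.unpair.1 l.length.unpair.2.unpair.2.unpair.1
      (E.count l.length.unpair.2.unpair.2.unpair.2)
  else if l.length.unpair.1 = 5 then
    !isMem E (l.getD l.length.unpair.2.unpair.1 []) ||
      isMem E (l.getD l.length.unpair.2.unpair.2 [])
  else (E.splits b).all fun E' => isMem E' (l.getD l.length.unpair.2 [])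

/-- A bound for the finite cardinalities that matter for formulas with code at most `e`. -/
def countBound (e : ℕ) : ℕ := 2 ^ e * (1 + e.factorial)

/-- The environments in which the formula with a given code is true. -/
def trueEnvs : ℕ → ℕ → List Env :=
  courseRec fun e l => (envs (countBound e) e).filter (isTrueAt (countBound e) l)

open Primrec

theorem primrec_addCount : Primrec₂ addCount :=
  option_bind fst (option_map (snd.comp fst) (nat_add.comp (snd.comp fst) snd))

theorem primrec_count : Primrec₂ Env.count := by
  have h1 : Primrec₂ fun (p : Env × ℕ) (m : List Bool × Option ℕ) => termValue m.1 p.2 :=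
    primrec_termValue.comp (fst.comp snd) (snd.comp fst)
  have h2 : Primrec₂ fun (_ : Env × ℕ) (q : (List Bool × Option ℕ) × Option ℕ) =>
      addCount q.1.2 q.2 :=
    primrec_addCount.comp (snd.comp (fst.comp snd)) (snd.comp snd)
  exact list_foldr (primrec_filter fst h1) (const (some 0)) h2

theorem primrec_splitCount : Primrec₂ splitCount := by
  have h1 : Primrec₂ fun (_ : ℕ × Option ℕ) (n : ℕ) => ((some n, none) : Option ℕ × Option ℕ) :=
    (option_some.comp snd).pair (const none)
  have h2 : Primrec₂ fun (_ : ℕ × Option ℕ) (n : ℕ) => ((none, some n) : Option ℕ × Option ℕ) :=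
    (const none).pair (option_some.comp snd)
  have h3 : Primrec₂ fun (p : (ℕ × Option ℕ) × ℕ) (n : ℕ) =>
      ((some n, some (p.2 - n)) : Option ℕ × Option ℕ) :=
    (option_some.comp snd).pair (option_some.comp (nat_sub.comp (snd.comp fst) snd))
  refine (option_casesOn snd
    (list_cons.comp (const (none, none)) (list_append.comp (list_map (list_range.comp fst) h1)
      (list_map (list_range.comp fst) h2)))
    (list_map (list_range.comp (succ.comp snd)) h3).to₂).of_eq fun p => ?_
  obtain ⟨b, _ | c⟩ := p <;> rfl

theorem primrec_splits : Primrec₂ Env.splits := by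
  have h1 : Primrec₂ fun (p : ((ℕ × Env) × ((List Bool × Option ℕ) × List Env)) ×
      (Option ℕ × Option ℕ)) (E' : Env) =>
      ((p.1.2.1.1 ++ [true], p.2.1) :: (p.1.2.1.1 ++ [false], p.2.2) :: E' : Env) := by
    have hv := fst.comp (fst.comp (snd.comp (fst.comp (fst (α := ((ℕ × Env) ×
      ((List Bool × Option ℕ) × List Env)) × (Option ℕ × Option ℕ)) (β := Env)))))
    exact list_cons.comp ((list_concat.comp hv (const true)).pair (fst.comp (snd.comp fst)))
      (list_cons.comp ((list_concat.comp hv (const false)).pair (snd.comp (snd.comp fst))) snd)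
  have h2 : Primrec₂ fun (p : ℕ × Env) (q : (List Bool × Option ℕ) × List Env) =>
      (splitCount p.1 q.1.2).flatMap fun c =>
        q.2.map fun E' => ((q.1.1 ++ [true], c.1) :: (q.1.1 ++ [false], c.2) :: E' : Env) :=
    list_flatMap (primrec_splitCount.comp (fst.comp fst) (snd.comp (fst.comp snd)))
      (list_map (snd.comp (snd.comp fst)) h1)
  exact list_foldr snd (const [ [] ]) h2

theorem primrec_envs : Primrec₂ envs := by
  have h1 : Primrec₂ fun (b : ℕ) (p : ℕ × List Env) => p.2 ++ p.2.flatMap (Env.splits b) :=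
    list_append.comp (snd.comp snd)
      (list_flatMap (snd.comp snd) (primrec_splits.comp (fst.comp fst) snd))
  refine (nat_rec (const [ [([], none)] ]) h1).of_eq fun b j => ?_
  induction j with
  | zero => rfl
  | succ j ih =>
    simp only [envs] at ih ⊢
    rw [← ih]

theorem primrec_leCount : Primrec₂ leCount := by
  refine (option_casesOn snd (const true) (nat_le.decide.comp (fst.comp fst) snd).to₂).of_eq
    fun p => ?_
  obtain ⟨n, _ | m⟩ := p <;> rfl

theorem primrec_resCount : Primrec fun p : ℕ × ℕ × Option ℕ => resCount p.1 p.2.1 p.2.2 := by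
  have hn : Primrec fun p : (ℕ × ℕ × Option ℕ) × ℕ => p.1.1 := fst.comp fst
  have hr : Primrec fun p : (ℕ × ℕ × Option ℕ) × ℕ => p.1.2.1 := fst.comp (snd.comp fst)
  have hr2 := nat_div.comp hr (const 2)
  refine (option_casesOn (snd.comp snd) (const false)
    (primrec_ite_eq (nat_mod.comp hr (const 2)) 0
      (Primrec.eq.decide.comp (nat_mod.comp snd hn) (nat_mod.comp hr2 hn))
      (Primrec.eq.decide.comp (nat_mod.comp (succ.comp (nat_add.comp snd hr2)) hn)
        (const 0))).to₂).of_eq fun p => ?_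
  obtain ⟨n, r, _ | m⟩ := p <;> rfl

theorem primrec_isTrueAt :
    Primrec fun p : ℕ × List (List Env) × Env => isTrueAt p.1 p.2.1 p.2.2 := by
  have hl : Primrec fun p : ℕ × List (List Env) × Env => p.2.1 := fst.comp snd
  have hE : Primrec fun p : ℕ × List (List Env) × Env => p.2.2 := snd.comp snd
  have hn := unpair.comp (list_length.comp hl)
  have h1 := fst.comp hn
  have h2 := snd.comp hn
  have h21 := fst.comp (unpair.comp h2)
  have h22 := snd.comp (unpair.comp h2)
  have h221 := fst.comp (unpair.comp h22)
  have h222 := snd.comp (unpair.comp h22)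
  have e1 : Primrec₂ fun (p : ℕ × List (List Env) × Env) (m : List Bool × Option ℕ) =>
      decide (m.2 = some 0) || decide (termValue m.1 p.2.1.length.unpair.2.unpair.1 =
        termValue m.1 p.2.1.length.unpair.2.unpair.2) :=
    Primrec.or.comp (Primrec.eq.decide.comp (snd.comp snd) (const (some 0)))
      (Primrec.eq.decide.comp (primrec_termValue.comp (fst.comp snd) (h21.comp fst))
        (primrec_termValue.comp (fst.comp snd) (h22.comp fst)))
  have e6 : Primrec₂ fun (p : ℕ × List (List Env) × Env) (E' : Env) =>
      isMem E' (p.2.1.getD p.2.1.length.unpair.2 []) :=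
    primrec_isMem.comp snd ((list_getD []).comp (hl.comp fst) (h2.comp fst))
  exact primrec_ite_eq h1 0 (const false) <|
    primrec_ite_eq h1 1 (primrec_all hE e1) <|
    primrec_ite_eq h1 2 (primrec_leCount.comp h21 (primrec_count.comp hE h22)) <|
    primrec_ite_eq h1 3 (option_isSome.comp (primrec_count.comp hE h2)) <|
    primrec_ite_eq h1 4
      (primrec_resCount.comp (h21.pair (h221.pair (primrec_count.comp hE h222)))) <|
    primrec_ite_eq h1 5 (Primrec.or.comp
      (Primrec.not.comp (primrec_isMem.comp hE ((list_getD []).comp hl h21)))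
      (primrec_isMem.comp hE ((list_getD []).comp hl h22)))
      (primrec_all (primrec_splits.comp fst hE) e6)

theorem primrec_countBound : Primrec countBound := by
  have hpow : Primrec₂ ((· ^ ·) : ℕ → ℕ → ℕ) := Primrec₂.unpaired'.1 Nat.Primrec.pow
  have hfac : Primrec Nat.factorial := by
    have : Primrec₂ fun (n m : ℕ) => (n + 1) * m := nat_mul.comp (succ.comp fst) snd
    refine (nat_rec₁ 1 this).of_eq fun n => ?_
    induction n with
    | zero => rfl
    | succ n ih => simp only [Nat.factorial] at ih ⊢; rw [← ih]
  exact nat_mul.comp (hpow.comp (const 2) Primrec.id) (nat_add.comp (const 1) hfac)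

theorem primrec_trueEnvs : Primrec₂ trueEnvs :=
  primrec_courseRec <| primrec_filter (primrec_envs.comp (primrec_countBound.comp fst) fst)
    (primrec_isTrueAt.comp ((primrec_countBound.comp (fst.comp fst)).pair
      ((snd.comp fst).pair snd)))

end Formulas

/-! ### Correctness of the recursions on codes, and bounds in terms of codes. -/

section Codes

/-- Constructors with subterms or subformulas carry positive tags, so their components have smaller
codes and every table lookup is in range. -/
theorem lt_pair {a b : ℕ} (h : 0 < a) : b < Nat.pair a b := by
  have := Nat.add_le_pair a b
  omega

theorem lt_pair_left {a b c : ℕ} (h : 0 < a) : b < Nat.pair a (Nat.pair b c) :=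
  (Nat.left_le_pair b c).trans_lt (lt_pair h)

theorem lt_pair_right {a b c : ℕ} (h : 0 < a) : c < Nat.pair a (Nat.pair b c) :=
  (Nat.right_le_pair b c).trans_lt (lt_pair h)

theorem termValue_termCode (v : List Bool) {k : ℕ} (t : Tm Empty k) :
    termValue v (termCode t) =
      truth (Sum.elim Empty.elim fun i : Fin k => v.getD i false) t := by
  induction t with
  | var i =>
    rcases i with e | i
    · exact e.elim
    · simp [termValue, courseRec, termValueStep, length_valueTable, termCode, truth]
  | func f ts ih =>
    cases f with
    | bot => simp [termValue, courseRec, termValueStep, length_valueTable, termCode, truth]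
    | top => simp [termValue, courseRec, termValueStep, length_valueTable, termCode, truth]
    | compl =>
      have h := ih 0
      rw [termValue] at h ⊢
      rw [courseRec, termValueStep, length_valueTable]
      simp only [termCode, Nat.unpair_pair, truth, ← h]
      rw [getD_valueTable _ _ _ (lt_pair (by norm_num))]
      simp
    | inf =>
      have h0 := ih 0
      have h1 := ih 1
      rw [termValue] at h0 h1 ⊢
      rw [courseRec, termValueStep, length_valueTable]
      simp only [termCode, Nat.unpair_pair, truth, ← h0, ← h1]
      rw [getD_valueTable _ _ _ (lt_pair_left (by norm_num)),
        getD_valueTable _ _ _ (lt_pair_right (by norm_num))]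
      simp
    | sup =>
      have h0 := ih 0
      have h1 := ih 1
      rw [termValue] at h0 h1 ⊢
      rw [courseRec, termValueStep, length_valueTable]
      simp only [termCode, Nat.unpair_pair, truth, ← h0, ← h1]
      rw [getD_valueTable _ _ _ (lt_pair_left (by norm_num)),
        getD_valueTable _ _ _ (lt_pair_right (by norm_num))]
      simp

theorem unpair_lt {t c : ℕ} (h : 0 < t) : c.unpair.1 < Nat.pair t c ∧ c.unpair.2 < Nat.pair t c :=
  ⟨(Nat.unpair_left_le c).trans_lt (lt_pair h), (Nat.unpair_right_le c).trans_lt (lt_pair h)⟩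

theorem isTermCode_pair (k t c : ℕ) : isTermCode k (Nat.pair t c) =
    if t = 0 then decide (c < k) else if t = 1 then decide (c = 0)
    else if t = 2 then decide (c = 0) else if t = 3 then isTermCode k c
    else if t = 4 then isTermCode k c.unpair.1 && isTermCode k c.unpair.2
    else if t = 5 then isTermCode k c.unpair.1 && isTermCode k c.unpair.2
    else false := by
  rw [isTermCode, courseRec, isTermCodeStep, length_valueTable, Nat.unpair_pair]
  rcases Nat.eq_zero_or_pos t with rfl | ht
  · simp
  · rw [getD_valueTable _ _ _ (lt_pair ht), getD_valueTable _ _ _ (unpair_lt ht).1,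
      getD_valueTable _ _ _ (unpair_lt ht).2]

theorem isTermCode_iff (k n : ℕ) : isTermCode k n = true ↔ ∃ t : Tm Empty k, termCode t = n := by
  constructor
  · induction n using Nat.strong_induction_on with
    | _ n ih =>
      obtain ⟨t, c, rfl⟩ : ∃ t c, n = Nat.pair t c := ⟨_, _, (Nat.pair_unpair n).symm⟩
      intro h
      rw [isTermCode_pair] at h
      split_ifs at h with h0 h1 h2 h3 h4 h5
      · exact ⟨.var (.inr ⟨c, by simpa using h⟩), by simp [termCode, h0]⟩
      · exact ⟨.func (l := 0) (L := lang) Func.bot ![], by simp_all [termCode]⟩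
      · exact ⟨.func (l := 0) (L := lang) Func.top ![], by simp_all [termCode]⟩
      · obtain ⟨s, hs⟩ := ih c (lt_pair (by omega)) h
        exact ⟨.func (l := 1) (L := lang) Func.compl ![s], by simp [termCode, h3, hs]⟩
      · rw [Bool.and_eq_true] at h
        obtain ⟨s, hs⟩ := ih _ (unpair_lt (by omega)).1 h.1
        obtain ⟨u, hu⟩ := ih _ (unpair_lt (by omega)).2 h.2
        exact ⟨.func (l := 2) (L := lang) Func.inf ![s, u], by simp [termCode, h4, hs, hu]⟩
      · rw [Bool.and_eq_true] at h
        obtain ⟨s, hs⟩ := ih _ (unpair_lt (by omega)).1 h.1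
        obtain ⟨u, hu⟩ := ih _ (unpair_lt (by omega)).2 h.2
        exact ⟨.func (l := 2) (L := lang) Func.sup ![s, u], by simp [termCode, h5, hs, hu]⟩
  · rintro ⟨t, rfl⟩
    induction t with
    | var i =>
      rcases i with e | i
      · exact e.elim
      · simp [termCode, isTermCode_pair]
    | func f ts ih => cases f <;> simp [termCode, isTermCode_pair, ih]

theorem mem_formulaLevels_pair (e t c k : ℕ) : k ∈ formulaLevels e (Nat.pair t c) ↔ k ≤ e ∧
    if t = 0 then c = 0
    else if t = 1 then isTermCode k c.unpair.1 = true ∧ isTermCode k c.unpair.2 = true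
    else if t = 2 then 0 < c.unpair.1 ∧ isTermCode k c.unpair.2 = true
    else if t = 3 then isTermCode k c = true
    else if t = 4 then 0 < c.unpair.1 ∧ isTermCode k c.unpair.2.unpair.2 = true
    else if t = 5 then k ∈ formulaLevels e c.unpair.1 ∧ k ∈ formulaLevels e c.unpair.2
    else t = 6 ∧ k + 1 ∈ formulaLevels e c := by
  rw [formulaLevels, courseRec, List.mem_filter, List.mem_range, Nat.lt_succ_iff, isFormulaCodeAt,
    length_valueTable, Nat.unpair_pair]
  refine and_congr_right fun _ => ?_
  rcases Nat.eq_zero_or_pos t with rfl | ht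
  · simp
  · rw [getD_valueTable _ _ _ (lt_pair ht), getD_valueTable _ _ _ (unpair_lt ht).1,
      getD_valueTable _ _ _ (unpair_lt ht).2]
    dsimp only
    split_ifs <;> simp_all [isMem_iff]

/-- The bound `k + n ≤ e` survives the recursion: a quantifier raises `k` by one but lowers the code
by at least one. -/
theorem mem_formulaLevels_iff {e n k : ℕ} (h : k + n ≤ e) :
    k ∈ formulaLevels e n ↔ ∃ φ : Fm Empty k, formulaCode φ = n := by
  constructor
  · induction n using Nat.strong_induction_on generalizing k with
    | _ n ih =>
      obtain ⟨t, c, rfl⟩ : ∃ t c, n = Nat.pair t c := ⟨_, _, (Nat.pair_unpair n).symm⟩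
      intro hk
      have hlt := lt_pair (a := t) (b := c)
      have hlt' := unpair_lt (t := t) (c := c)
      rw [mem_formulaLevels_pair] at hk
      obtain ⟨-, hk⟩ := hk
      split_ifs at hk with h0 h1 h2 h3 h4 h5
      · exact ⟨.falsum, by simp [formulaCode, h0, hk]⟩
      · rw [isTermCode_iff, isTermCode_iff] at hk
        obtain ⟨⟨s, hs⟩, u, hu⟩ := hk
        exact ⟨.equal s u, by simp [formulaCode, h1, hs, hu]⟩
      · rw [isTermCode_iff] at hk
        obtain ⟨hp, s, hs⟩ := hk
        exact ⟨.rel (l := 1) (L := lang) (Rel.C ⟨_, hp⟩) ![s], by simp [formulaCode, h2, hs]⟩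
      · rw [isTermCode_iff] at hk
        obtain ⟨s, hs⟩ := hk
        exact ⟨.rel (l := 1) (L := lang) Rel.fin ![s], by simp [formulaCode, h3, hs]⟩
      · rw [isTermCode_iff] at hk
        obtain ⟨hp, s, hs⟩ := hk
        exact ⟨.rel (l := 1) (L := lang)
          (Rel.res ⟨_, hp⟩ (Equiv.intEquivNat.symm c.unpair.2.unpair.1)) ![s],
          by simp [formulaCode, h4, hs]⟩
      · obtain ⟨φ, hφ⟩ := ih _ (hlt' (by omega)).1 (by have := hlt' (by omega); omega) hk.1
        obtain ⟨ψ, hψ⟩ := ih _ (hlt' (by omega)).2 (by have := hlt' (by omega); omega) hk.2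
        exact ⟨.imp φ ψ, by simp [formulaCode, h5, hφ, hψ]⟩
      · obtain ⟨φ, hφ⟩ := ih _ (hlt (by omega)) (by have := hlt (by omega); omega) hk.2
        exact ⟨.all φ, by simp [formulaCode, hk.1, hφ]⟩
  · rintro ⟨φ, rfl⟩
    induction φ with
    | falsum => simp [formulaCode, mem_formulaLevels_pair]; omega
    | equal s u =>
      simp only [formulaCode, mem_formulaLevels_pair, Nat.unpair_pair, isTermCode_iff]
      exact ⟨by omega, by simp⟩
    | rel R ts =>
      cases R <;> simp only [formulaCode, mem_formulaLevels_pair, Nat.unpair_pair, isTermCode_iff]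
      all_goals exact ⟨by omega, by simp⟩
    | imp φ ψ ih1 ih2 =>
      rw [formulaCode] at h ⊢
      have h1 := lt_pair_left (a := 5) (b := formulaCode φ) (c := formulaCode ψ) (by norm_num)
      have h2 := lt_pair_right (a := 5) (b := formulaCode φ) (c := formulaCode ψ) (by norm_num)
      rw [mem_formulaLevels_pair]
      simp only [Nat.unpair_pair]
      exact ⟨by omega, by simpa using ⟨ih1 (by omega), ih2 (by omega)⟩⟩
    | all φ ih =>
      rw [formulaCode] at h ⊢
      have h1 := lt_pair (a := 6) (b := formulaCode φ) (by norm_num)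
      rw [mem_formulaLevels_pair]
      exact ⟨by omega, by simpa using ih (by omega)⟩

/-- The modulus for formulas with code at most `e`. -/
def factorialPNat (e : ℕ) : ℕ+ := ⟨e.factorial, e.factorial_pos⟩

/-- A modulus in a formula is smaller than the code of the formula, hence divides `e.factorial`. -/
theorem moduliDvd_of_code_le {e k : ℕ} (φ : Fm Empty k) (h : formulaCode φ ≤ e) :
    ModuliDvd (factorialPNat e) φ := by
  induction φ with
  | falsum => trivial
  | equal => trivial
  | rel R ts =>
    cases R with
    | C => trivial
    | fin => trivial
    | res n r =>
      rw [formulaCode] at h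
      have := lt_pair_left (a := 4) (b := n)
        (c := Nat.pair (Equiv.intEquivNat r) (termCode (ts 0))) (by norm_num)
      exact Nat.dvd_factorial n.pos (by omega)
  | imp φ ψ ih1 ih2 =>
    rw [formulaCode] at h
    have h1 := lt_pair_left (a := 5) (b := formulaCode φ) (c := formulaCode ψ) (by norm_num)
    have h2 := lt_pair_right (a := 5) (b := formulaCode φ) (c := formulaCode ψ) (by norm_num)
    exact ⟨ih1 (by omega), ih2 (by omega)⟩
  | all φ ih =>
    rw [formulaCode] at h
    have h1 := lt_pair (a := 6) (b := formulaCode φ) (by norm_num)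
    exact ih (by omega)

/-- A quantifier doubles `rank + M`, as `(2 * r + M) + M = 2 * (r + M)`, and increases the code by
at least one. -/
theorem rank_add_le (M : ℕ+) {k : ℕ} (φ : Fm Empty k) :
    rank M φ + M ≤ 2 ^ formulaCode φ * (1 + M) := by
  have base (m c : ℕ) (h : m ≤ c) : m + M ≤ 2 ^ c * (1 + M) := by
    have := Nat.lt_two_pow_self (n := c)
    nlinarith [M.pos]
  have step {c d : ℕ} (h : c ≤ d) : 2 ^ c * (1 + M : ℕ) ≤ 2 ^ d * (1 + M) :=
    Nat.mul_le_mul_right _ (Nat.pow_le_pow_right (by norm_num) h)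
  induction φ with
  | falsum => exact base 0 _ (by omega)
  | equal s t =>
    refine base 1 _ ?_
    rw [formulaCode]
    exact Nat.left_le_pair 1 _
  | rel R ts =>
    cases R with
    | C n =>
      refine base n _ ?_
      rw [formulaCode]
      exact (lt_pair_left (by norm_num)).le
    | fin => exact base 0 _ (by omega)
    | res => exact base 0 _ (by omega)
  | imp φ ψ ih1 ih2 =>
    have h1 := lt_pair_left (a := 5) (b := formulaCode φ) (c := formulaCode ψ) (by norm_num)
    have h2 := lt_pair_right (a := 5) (b := formulaCode φ) (c := formulaCode ψ) (by norm_num)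
    rw [rank, formulaCode, ← max_add_add_right]
    exact max_le (ih1.trans (step h1.le)) (ih2.trans (step h2.le))
  | all φ ih =>
    have h1 := lt_pair (a := 6) (b := formulaCode φ) (by norm_num)
    rw [rank, formulaCode]
    refine le_trans ?_ (step h1)
    rw [pow_succ]
    linarith

theorem rank_add_le_countBound {e k : ℕ} (φ : Fm Empty k) (h : formulaCode φ ≤ e) :
    rank (factorialPNat e) φ + factorialPNat e ≤ countBound e :=
  (rank_add_le _ φ).trans
    (Nat.mul_le_mul_right _ (Nat.pow_le_pow_right (by norm_num) h))

end Codes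

/-! ### Cardinalities of sets and of their parts. -/

section Cardinality

open Classical in
/-- The cardinality of a set, where `none` stands for infinity. -/
noncomputable def setCount {I : Type*} (s : Set I) : Option ℕ :=
  if s.Finite then some s.ncard else none

variable {I : Type*} {s t : Set I}

theorem setCount_eq_none : setCount s = none ↔ s.Infinite := by
  rw [setCount]
  split_ifs with h
  · simp [h]
  · exact iff_of_true rfl h

theorem setCount_eq_some {n : ℕ} : setCount s = some n ↔ s.encard = n := by
  rw [setCount]
  split_ifs with h
  · rw [Option.some_inj, ← h.cast_ncard_eq]
    norm_cast
  · simp [Set.Infinite.encard_eq h]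

theorem setCount_union (h : Disjoint s t) :
    setCount (s ∪ t) = addCount (setCount s) (setCount t) := by
  by_cases hs : s.Finite
  · by_cases ht : t.Finite
    · simp [setCount, hs, ht, addCount, Set.ncard_union_eq h hs ht]
    · have : ¬ (s ∪ t).Finite := fun h => ht (h.subset Set.subset_union_right)
      simp [setCount, ht, addCount, hs]
  · simp [setCount, hs, addCount]

theorem setCount_isSome : (setCount s).isSome = true ↔ s.Finite := by
  rw [setCount]
  split_ifs with h <;> simp [h]

theorem leCount_setCount {n : ℕ} : leCount n (setCount s) = true ↔ (n : ℕ∞) ≤ s.encard := by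
  rw [setCount]
  split_ifs with h
  · rw [← h.cast_ncard_eq]
    simp [leCount]
  · simp [leCount, Set.Infinite.encard_eq h]

theorem resCount_setCount (n : ℕ) (r : ℤ) :
    resCount n (Equiv.intEquivNat r) (setCount s) = true ↔
      s.Finite ∧ (s.ncard : ℤ) ≡ r [ZMOD (n : ℤ)] := by
  rw [setCount]
  split_ifs with h
  · simp only [resCount, h, true_and]
    cases r with
    | ofNat j =>
      rw [show Equiv.intEquivNat (Int.ofNat j) = 2 * j from rfl]
      simp [Int.natCast_modEq_iff, Nat.ModEq]
    | negSucc j =>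
      rw [show Equiv.intEquivNat (Int.negSucc j) = 2 * j + 1 from rfl]
      have h1 : (2 * j + 1) % 2 = 1 := by omega
      have h2 : (2 * j + 1) / 2 = j := by omega
      simp only [h1, h2, one_ne_zero, if_false, decide_eq_true_iff]
      rw [Int.modEq_comm, Int.modEq_iff_dvd, ← Nat.dvd_iff_mod_eq_zero, ← Int.natCast_dvd_natCast,
        Int.negSucc_eq]
      push_cast
      ring_nf
  · simp [resCount, h]

/-- Soundness of `splitCount`: only splittings that actually occur are listed. -/
theorem exists_subset_of_mem_splitCount {b : ℕ} {c : Option ℕ × Option ℕ}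
    (h : c ∈ splitCount b (setCount s)) :
    ∃ t ⊆ s, setCount t = c.1 ∧ setCount (s \ t) = c.2 := by
  by_cases hs : s.Finite
  · rw [setCount, if_pos hs, splitCount, List.mem_map] at h
    obtain ⟨n, hn, rfl⟩ := h
    rw [List.mem_range, Nat.lt_succ_iff] at hn
    obtain ⟨t, ht, hc⟩ := Set.exists_subset_card_eq hn
    have htf := hs.subset ht
    refine ⟨t, ht, by simp [setCount, htf, hc], ?_⟩
    simp [setCount, hs.subset Set.sdiff_subset, Set.ncard_sdiff ht htf, hc]
  · have small (n : ℕ) : ∃ t ⊆ s, setCount t = some n ∧ setCount (s \ t) = none := by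
      obtain ⟨t, ht, hc⟩ := Set.exists_subset_encard_eq (s := s) (k := n)
        (by rw [Set.Infinite.encard_eq hs]; exact le_top)
      exact ⟨t, ht, setCount_eq_some.2 hc,
        setCount_eq_none.2 (Set.Infinite.sdiff hs (Set.finite_of_encard_eq_coe hc))⟩
    rw [setCount, if_neg hs, splitCount, List.mem_cons, List.mem_append, List.mem_map,
      List.mem_map] at h
    rcases h with rfl | ⟨n, -, rfl⟩ | ⟨n, -, rfl⟩
    · have := Set.infinite_coe_iff.2 hs
      have : Infinite I := Infinite.of_injective (Subtype.val : s → I) Subtype.val_injective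
      obtain ⟨u, hu, h1, h2⟩ := (isPresburgerAlgebra_set I).exists_split s hs
      exact ⟨u, hu.le, setCount_eq_none.2 h1, setCount_eq_none.2 h2⟩
    · exact small n
    · obtain ⟨t, ht, h1, h2⟩ := small n
      exact ⟨s \ t, Set.sdiff_subset, h2, by rwa [Set.sdiff_sdiff_cancel_left ht]⟩

/-- Every division of a set of natural numbers is similar to one that is taken into account by
`splitCount`. -/
theorem exists_similar_mem_splitCount {N b : ℕ} {M : ℕ+} {s t : Set ℕ} (hb : N + M ≤ b)
    (ht : t ⊆ s) : ∃ u ⊆ s, (setCount u, setCount (s \ u)) ∈ splitCount b (setCount s) ∧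
      Similar N M t u ∧ Similar N M (s \ t) (s \ u) := by
  have H := isPresburgerAlgebra_set ℕ
  have refl (a : Set ℕ) : Similar N M a a := ⟨fun _ _ => Iff.rfl, Iff.rfl, fun _ => Iff.rfl⟩
  -- For finite `s` every splitting is listed and `t` itself serves. For infinite `s`, a finite part
  -- is replaced by one with fewer than `N + M` elements.
  by_cases hs : s.Finite
  · refine ⟨t, ht, ?_, refl _, refl _⟩
    have htf := hs.subset ht
    have hc := Set.ncard_le_ncard ht hs
    rw [setCount, setCount, setCount, if_pos hs, if_pos htf, if_pos (hs.subset Set.sdiff_subset),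
      splitCount, List.mem_map]
    exact ⟨t.ncard, List.mem_range.2 (by omega), by rw [Set.ncard_sdiff ht htf]⟩
  have small (t : Set ℕ) (ht : t ⊆ s) (htf : t.Finite) : ∃ n < b, ∃ u ⊆ s,
      setCount u = some n ∧ setCount (s \ u) = none ∧ Similar N M t u ∧
        Similar N M (s \ t) (s \ u) := by
    obtain ⟨n, hn, h⟩ := exists_small_count H H N M (a := t) htf
    obtain ⟨u, hu, hc⟩ := Set.exists_subset_encard_eq (s := s) (k := n)
      (by rw [Set.Infinite.encard_eq hs]; exact le_top)
    have huf := Set.finite_of_encard_eq_coe hc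
    exact ⟨n, by omega, u, hu, setCount_eq_some.2 hc,
      setCount_eq_none.2 (Set.Infinite.sdiff hs huf), h u (by rw [atomCount_set, hc]),
      similar_of_not_fin H H (Set.Infinite.sdiff hs htf) (Set.Infinite.sdiff hs huf)⟩
  have hnone : setCount s = none := setCount_eq_none.2 hs
  rw [hnone]
  by_cases htf : t.Finite
  · obtain ⟨n, hn, u, hu, h1, h2, h3, h4⟩ := small t ht htf
    refine ⟨u, hu, ?_, h3, h4⟩
    rw [h1, h2]
    simp [splitCount, hn]
  by_cases htf' : (s \ t).Finite
  · obtain ⟨n, hn, u, hu, h1, h2, h3, h4⟩ := small (s \ t) Set.sdiff_subset htf'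
    rw [Set.sdiff_sdiff_cancel_left ht] at h4
    refine ⟨s \ u, Set.sdiff_subset, ?_, h4, ?_⟩
    · rw [Set.sdiff_sdiff_cancel_left hu, h1, h2]
      simp [splitCount, hn]
    · rwa [Set.sdiff_sdiff_cancel_left hu]
  · refine ⟨t, ht, ?_, refl _, refl _⟩
    rw [setCount_eq_none.2 htf, setCount_eq_none.2 htf']
    simp [splitCount]

end Cardinality

/-! ### Cells of tuples of sets and the extension of environments. -/

section Cells

/-- All patterns of length `k`. -/
def patterns : ℕ → List (List Bool)
  | 0 => [ [] ]
  | k + 1 => (patterns k).flatMap fun v => [v ++ [true], v ++ [false] ]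

open Classical in
/-- The pattern of a point. -/
noncomputable def pointPattern {k : ℕ} (x : Fin k → Set ℕ) (n : ℕ) : List Bool :=
  List.ofFn fun i => decide (n ∈ x i)

/-- The points with a given pattern. -/
def cell {k : ℕ} (x : Fin k → Set ℕ) (v : List Bool) : Set ℕ := {n | pointPattern x n = v}

/-- The environment of a tuple. -/
noncomputable def envOf {k : ℕ} (x : Fin k → Set ℕ) : Env :=
  (patterns k).map fun v => (v, setCount (cell x v))

theorem nodup_patterns (k : ℕ) : (patterns k).Nodup := by
  induction k with
  | zero => simp [patterns]
  | succ k ih =>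
    rw [patterns, List.nodup_flatMap]
    refine ⟨fun v _ => by simp, ih.imp fun {v w} h => ?_⟩
    simp only [Function.onFun, List.disjoint_cons_left, List.mem_cons, List.not_mem_nil, or_false,
      List.disjoint_nil_left, and_true]
    simp [h]

theorem mem_patterns {k : ℕ} {v : List Bool} : v ∈ patterns k ↔ v.length = k := by
  induction k generalizing v with
  | zero => simp [patterns]
  | succ k ih =>
    simp only [patterns, List.mem_flatMap, ih, List.mem_cons, List.not_mem_nil, or_false]
    constructor
    · rintro ⟨w, rfl, rfl | rfl⟩ <;> simp
    · intro h
      rcases List.eq_nil_or_concat' v with rfl | ⟨w, b, rfl⟩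
      · simp at h
      · refine ⟨w, by simpa using h, ?_⟩
        cases b <;> simp

theorem pointPattern_snoc {k : ℕ} (x : Fin k → Set ℕ) (y : Set ℕ) (n : ℕ) [Decidable (n ∈ y)] :
    pointPattern (Fin.snoc x y : Fin (k + 1) → Set ℕ) n = pointPattern x n ++ [decide (n ∈ y)] := by
  rw [pointPattern, pointPattern, List.ofFn_succ', List.concat_eq_append]
  refine congrArg₂ _ (congrArg List.ofFn (funext fun i => ?_)) (congrArg (fun b => [b]) ?_) <;>
    rw [decide_eq_decide]
  · rw [Fin.snoc_castSucc (α := fun _ => Set ℕ)]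
  · rw [Fin.snoc_last (α := fun _ => Set ℕ)]

theorem cell_snoc_true {k : ℕ} (x : Fin k → Set ℕ) (y : Set ℕ) (v : List Bool) :
    cell (Fin.snoc x y : Fin (k + 1) → Set ℕ) (v ++ [true]) = cell x v ∩ y := by
  classical
  ext n
  simp [cell, pointPattern_snoc]

theorem cell_snoc_false {k : ℕ} (x : Fin k → Set ℕ) (y : Set ℕ) (v : List Bool) :
    cell (Fin.snoc x y : Fin (k + 1) → Set ℕ) (v ++ [false]) = cell x v \ y := by
  classical
  ext n
  simp [cell, pointPattern_snoc]

theorem envOf_snoc {k : ℕ} (x : Fin k → Set ℕ) (y : Set ℕ) :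
    envOf (Fin.snoc x y : Fin (k + 1) → Set ℕ) = (patterns k).flatMap fun v =>
      [(v ++ [true], setCount (cell x v ∩ y)), (v ++ [false], setCount (cell x v \ y))] := by
  simp [envOf, patterns, List.map_flatMap, cell_snoc_true, cell_snoc_false]

/-- The cells are split independently of each other; as patterns do not repeat, the choices form a
function `g`. -/
theorem mem_splits_iff {b : ℕ} {P : List (List Bool)} (hP : P.Nodup) (f : List Bool → Option ℕ)
    {E : Env} : E ∈ Env.splits b (P.map fun v => (v, f v)) ↔
      ∃ g : List Bool → Option ℕ × Option ℕ, (∀ v ∈ P, g v ∈ splitCount b (f v)) ∧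
        E = P.flatMap fun v => [(v ++ [true], (g v).1), (v ++ [false], (g v).2)] := by
  classical
  induction P generalizing E with
  | nil => simp [Env.splits]
  | cons v P ih =>
    have hv := (List.nodup_cons.1 hP).1
    have ih' := fun E => ih (List.nodup_cons.1 hP).2 (E := E)
    rw [List.map_cons, Env.splits, List.foldr_cons, List.mem_flatMap]
    simp only [List.mem_map]
    constructor
    · rintro ⟨c, hc, E', hE', rfl⟩
      obtain ⟨g, hg, rfl⟩ := (ih' E').1 hE'
      refine ⟨Function.update g v c, ?_, ?_⟩
      · intro w hw
        by_cases hwv : w = v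
        · subst hwv; simpa using hc
        · rw [Function.update_of_ne hwv]
          exact hg w ((List.mem_cons.1 hw).resolve_left hwv)
      · rw [List.flatMap_cons, Function.update_self]
        simp only [List.cons_append, List.nil_append]
        congr 2
        refine List.flatMap_congr fun w hw => ?_
        rw [Function.update_of_ne (fun h => hv (by rwa [← h]))]
    · rintro ⟨g, hg, rfl⟩
      exact ⟨g v, hg v (by simp), _, (ih' _).2 ⟨g, fun w hw => hg w (by simp [hw]), rfl⟩, by simp⟩

theorem exists_envOf_snoc {k b : ℕ} {x : Fin k → Set ℕ} {E : Env}
    (h : E ∈ Env.splits b (envOf x)) :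
    ∃ y, E = envOf (Fin.snoc x y : Fin (k + 1) → Set ℕ) := by
  obtain ⟨g, hg, rfl⟩ := (mem_splits_iff (nodup_patterns k) _).1 h
  choose! z hz h1 h2 using fun v hv => exists_subset_of_mem_splitCount (hg v hv)
  -- The new set consists of the points that lie in the piece chosen for their own cell.
  refine ⟨{n | n ∈ z (pointPattern x n)}, ?_⟩
  rw [envOf_snoc]
  refine List.flatMap_congr fun v hv => ?_
  have h3 : cell x v ∩ {n | n ∈ z (pointPattern x n)} = z v := by
    ext n
    constructor
    · rintro ⟨rfl, hn⟩; exact hn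
    · intro hn
      have := hz v hv hn
      exact ⟨this, by rwa [Set.mem_ofPred_eq, show pointPattern x n = v from this]⟩
  rw [← Set.sdiff_inter_self_eq_sdiff, Set.inter_comm _ (cell x v), h3, h1 v hv, h2 v hv]

theorem minterm_eq_cell {k : ℕ} (v : Empty → Set ℕ) (x : Fin k → Set ℕ)
    (p : Empty ⊕ Fin k → Bool) :
    minterm (Sum.elim v x) p = cell x (List.ofFn fun i => p (Sum.inr i)) := by
  ext n
  rw [← Set.singleton_subset_iff, le_minterm]
  simp only [Sum.forall, IsEmpty.forall_iff, true_and, Sum.elim_inr, cell, pointPattern,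
    Set.mem_ofPred_eq, List.ofFn_inj, funext_iff]
  refine forall_congr' fun i => ?_
  cases p (Sum.inr i) <;> simp

/-- Completeness of the search up to similarity: an arbitrary `y` can be replaced by some `z` whose
environment is listed. The replacement is made cell by cell. -/
theorem exists_mem_splits_similar {k b N : ℕ} {M : ℕ+} (hb : N + M ≤ b) (x : Fin k → Set ℕ)
    (y : Set ℕ) : ∃ z, envOf (Fin.snoc x z : Fin (k + 1) → Set ℕ) ∈ Env.splits b (envOf x) ∧
      ∀ v w : Empty → Set ℕ, TupleSimilar N M (Sum.elim v (Fin.snoc x y : Fin (k + 1) → Set ℕ))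
        (Sum.elim w (Fin.snoc x z : Fin (k + 1) → Set ℕ)) := by
  choose u hu h1 h2 h3 using fun v => exists_similar_mem_splitCount hb
    (Set.inter_subset_left : cell x v ∩ y ⊆ cell x v)
  have h4 (v) : cell x v ∩ {n | n ∈ u (pointPattern x n)} = u v := by
    ext n
    constructor
    · rintro ⟨rfl, hn⟩; exact hn
    · intro hn
      have := hu v hn
      exact ⟨this, by rwa [Set.mem_ofPred_eq, show pointPattern x n = v from this]⟩
  have h5 (v) : cell x v \ {n | n ∈ u (pointPattern x n)} = cell x v \ u v := by
    rw [← Set.sdiff_inter_self_eq_sdiff, Set.inter_comm _ (cell x v), h4]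
  refine ⟨{n | n ∈ u (pointPattern x n)}, ?_, fun v w q => ?_⟩
  · rw [envOf_snoc]
    refine (mem_splits_iff (nodup_patterns k) _).2
      ⟨fun v => (setCount (u v), setCount (cell x v \ u v)), fun v _ => h1 v, ?_⟩
    simp only [h4, h5]
  · rw [minterm_snoc, minterm_snoc, minterm_eq_cell, minterm_eq_cell]
    cases q (Sum.inr (Fin.last k))
    · have := h3 (List.ofFn fun i => (q ∘ Sum.map id Fin.castSucc) (Sum.inr i))
      rw [← h5, Set.sdiff_self_inter] at this
      simpa [← sdiff_eq] using this
    · have := h2 (List.ofFn fun i => (q ∘ Sum.map id Fin.castSucc) (Sum.inr i))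
      rw [← h4] at this
      simpa using this

end Cells

/-! ### Correctness of the evaluation, and decidability. -/

section Correctness

variable {k : ℕ}

/-- The singleton `{n}` is an atom, and its pattern is that of the point `n`. -/
theorem mem_realize_iff (v : Empty → Set ℕ) (x : Fin k → Set ℕ) (t : Tm Empty k) (n : ℕ) :
    n ∈ t.realize (Sum.elim v x) ↔ termValue (pointPattern x n) (termCode t) = true := by
  classical
  have h := (isPresburgerAlgebra_set ℕ).le_realize_iff (a := {n}) (Set.isAtom_singleton n)
    (Sum.elim v x) t
  rw [← Set.singleton_subset_iff]
  refine h.trans ?_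
  rw [termValue_termCode]
  suffices pattern (Sum.elim v x) {n} =
      Sum.elim Empty.elim fun i : Fin k => (pointPattern x n).getD i false by rw [this]
  funext i
  rcases i with e | i
  · exact e.elim
  · simp [pattern, pointPattern]

theorem pointPattern_mem (x : Fin k → Set ℕ) (n : ℕ) : pointPattern x n ∈ patterns k := by
  simp [mem_patterns, pointPattern]

theorem count_envOf (v : Empty → Set ℕ) (x : Fin k → Set ℕ) (t : Tm Empty k) :
    (envOf x).count (termCode t) = setCount (t.realize (Sum.elim v x)) := by
  -- The list of all patterns is generalized to an arbitrary list `P` without repetitions, for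
  -- induction; cells of different patterns are disjoint, so cardinalities add up.
  have key (P : List (List Bool)) (hP : P.Nodup) :
      Env.count (P.map fun v => (v, setCount (cell x v))) (termCode t) =
        setCount {n | pointPattern x n ∈ P ∧ n ∈ t.realize (Sum.elim v x)} := by
    induction P with
    | nil =>
      rw [eq_comm, Env.count, List.map_nil, List.filter_nil, Env.total, List.foldr_nil,
        setCount_eq_some]
      simp
    | cons w P ih =>
      have ih := ih (List.nodup_cons.1 hP).2
      have hw := (List.nodup_cons.1 hP).1
      rw [Env.count] at ih ⊢
      by_cases h : termValue w (termCode t) = true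
      · rw [List.map_cons, List.filter_cons, if_pos h, Env.total, List.foldr_cons, ← Env.total, ih,
          ← setCount_union]
        · congr 1
          ext n
          simp only [cell, Set.mem_union, Set.mem_ofPred_eq, List.mem_cons, mem_realize_iff]
          constructor
          · rintro (rfl | h1)
            · exact ⟨.inl rfl, h⟩
            · exact ⟨.inr h1.1, h1.2⟩
          · rintro ⟨h1 | h1, h2⟩
            · exact .inl h1
            · exact .inr ⟨h1, h2⟩
        · rw [Set.disjoint_left]
          rintro n rfl h1
          exact hw h1.1
      · rw [List.map_cons, List.filter_cons, if_neg h, ih]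
        congr 1
        ext n
        simp only [Set.mem_ofPred_eq, List.mem_cons, mem_realize_iff]
        constructor
        · rintro ⟨h1, h2⟩
          exact ⟨.inr h1, h2⟩
        · rintro ⟨rfl | h1, h2⟩
          · exact absurd h2 h
          · exact ⟨h1, h2⟩
  rw [envOf, key _ (nodup_patterns k)]
  congr 1
  ext n
  simp [pointPattern_mem]

theorem all_envOf_iff (v : Empty → Set ℕ) (x : Fin k → Set ℕ) (s t : Tm Empty k) :
    ((envOf x).all fun m => decide (m.2 = some 0) ||
      decide (termValue m.1 (termCode s) = termValue m.1 (termCode t))) = true ↔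
    s.realize (Sum.elim v x) = t.realize (Sum.elim v x) := by
  simp only [envOf, List.all_map, List.all_eq_true, Function.comp_apply, Bool.or_eq_true,
    decide_eq_true_iff, setCount_eq_some, Nat.cast_zero, Set.encard_eq_zero]
  constructor
  · intro h
    ext n
    rw [mem_realize_iff, mem_realize_iff]
    rcases h _ (pointPattern_mem x n) with h | h
    · exact absurd (show n ∈ cell x (pointPattern x n) from rfl) (h ▸ Set.notMem_empty n)
    · rw [h]
  · intro h w _
    rcases Set.eq_empty_or_nonempty (cell x w) with h0 | ⟨n, rfl⟩
    · exact .inl h0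
    · refine .inr ?_
      rw [Bool.eq_iff_iff, ← mem_realize_iff v, ← mem_realize_iff v, h]

theorem envs_mono {b i j : ℕ} {E : Env} (h : E ∈ envs b i) (hij : i ≤ j) : E ∈ envs b j := by
  induction j, hij using Nat.le_induction with
  | base => exact h
  | succ j _ ih => exact List.mem_append_left _ ih

theorem mem_envs_succ {b j : ℕ} {E E' : Env} (h : E ∈ envs b j) (h' : E' ∈ Env.splits b E) :
    E' ∈ envs b (j + 1) :=
  List.mem_append_right _ (List.mem_flatMap.2 ⟨E, h, h'⟩)

theorem mem_trueEnvs_pair (e t c : ℕ) (E : Env) : E ∈ trueEnvs e (Nat.pair t c) ↔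
    E ∈ envs (countBound e) e ∧
    if t = 0 then False
    else if t = 1 then
      (E.all fun m => decide (m.2 = some 0) ||
        decide (termValue m.1 c.unpair.1 = termValue m.1 c.unpair.2)) = true
    else if t = 2 then leCount c.unpair.1 (E.count c.unpair.2) = true
    else if t = 3 then (E.count c).isSome = true
    else if t = 4 then
      resCount c.unpair.1 c.unpair.2.unpair.1 (E.count c.unpair.2.unpair.2) = true
    else if t = 5 then E ∈ trueEnvs e c.unpair.1 → E ∈ trueEnvs e c.unpair.2
    else ∀ E' ∈ E.splits (countBound e), E' ∈ trueEnvs e c := by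
  rw [trueEnvs, courseRec, List.mem_filter, isTrueAt, length_valueTable, Nat.unpair_pair]
  refine and_congr_right fun _ => ?_
  rcases Nat.eq_zero_or_pos t with rfl | ht
  · simp
  · rw [getD_valueTable _ _ _ (lt_pair ht), getD_valueTable _ _ _ (unpair_lt ht).1,
      getD_valueTable _ _ _ (unpair_lt ht).2]
    dsimp only
    split_ifs
    iterate 5 rfl
    · simp only [Bool.or_eq_true, Bool.not_eq_true', ← Bool.not_eq_true, isMem_iff,
        imp_iff_not_or]
    · simp only [List.all_eq_true, isMem_iff]

/-- The index `j` counts the quantifiers already passed. Since each of them lowers the code, `j +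
formulaCode φ ≤ e` is preserved, and all environments needed occur in the list up to depth `e`. -/
theorem mem_trueEnvs_iff {e j : ℕ} (φ : Fm Empty k) (v : Empty → Set ℕ) (x : Fin k → Set ℕ)
    (hx : envOf x ∈ envs (countBound e) j) (he : j + formulaCode φ ≤ e) :
    envOf x ∈ trueEnvs e (formulaCode φ) ↔ φ.Realize v x := by
  have H := isPresburgerAlgebra_set ℕ
  induction φ generalizing j with
  | falsum =>
    rw [formulaCode, mem_trueEnvs_pair]
    simp [BoundedFormula.Realize]
  | equal s t =>
    have hx := envs_mono hx (show j ≤ e by omega)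
    rw [formulaCode, mem_trueEnvs_pair]
    simp only [Nat.unpair_pair]
    exact (and_iff_right hx).trans (all_envOf_iff v x s t)
  | rel R ts =>
    have hx := envs_mono hx (show j ≤ e by omega)
    cases R with
    | C n =>
      rw [formulaCode, mem_trueEnvs_pair, realize_rel_C, H.hasC_iff, atomCount_set,
        ← leCount_setCount, ← count_envOf]
      simp [hx]
    | fin =>
      rw [formulaCode, mem_trueEnvs_pair, realize_rel_fin]
      refine (and_iff_right hx).trans ?_
      rw [count_envOf v]
      exact setCount_isSome
    | res n r =>
      rw [formulaCode, mem_trueEnvs_pair, realize_rel_res]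
      simp only [Nat.unpair_pair]
      refine (and_iff_right hx).trans ?_
      rw [count_envOf v]
      exact resCount_setCount n r
  | imp φ ψ ih1 ih2 =>
    rw [formulaCode] at he ⊢
    have h1 := lt_pair_left (a := 5) (b := formulaCode φ) (c := formulaCode ψ) (by norm_num)
    have h2 := lt_pair_right (a := 5) (b := formulaCode φ) (c := formulaCode ψ) (by norm_num)
    rw [mem_trueEnvs_pair]
    simp only [Nat.unpair_pair]
    refine (and_iff_right (envs_mono hx (by omega))).trans ?_
    exact imp_congr (ih1 x hx (by omega)) (ih2 x hx (by omega))
  | all φ ih =>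
    rw [formulaCode] at he ⊢
    have h1 := lt_pair (a := 6) (b := formulaCode φ) (by norm_num)
    rw [mem_trueEnvs_pair]
    refine (and_iff_right (envs_mono hx (by omega))).trans ?_
    have hφ : formulaCode φ ≤ e := by omega
    constructor
    · intro h y
      -- The given `y` need not have a listed environment; `φ` does not distinguish it from the
      -- similar `z`, because `countBound e` is at least `rank + M`.
      obtain ⟨z, hz, hs⟩ := exists_mem_splits_similar (rank_add_le_countBound φ hφ) x y
      exact (TupleSimilar.realize_iff H H (moduliDvd_of_code_le φ hφ) (hs v v)).2
        ((ih _ (mem_envs_succ hx hz) (by omega)).1 (h _ hz))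
    · intro h E hE
      obtain ⟨y, rfl⟩ := exists_envOf_snoc hE
      exact (ih _ (mem_envs_succ hx hE) (by omega)).2 (h y)

/-- It is checked that `n` is the code of a formula without variables in scope and that this formula
is true in the environment of the empty tuple, whose single cell is all of `ℕ`. -/
theorem T₃_isDecidable : IsDecidable T₃ := by
  have h0 (x : Fin 0 → Set ℕ) : envOf x = [([], none)] := by
    have : cell x [] = Set.univ := by
      ext n
      simp [cell, pointPattern]
    simp [envOf, patterns, this, setCount_eq_none.2 Set.infinite_univ]
  have key (n : ℕ) : (∃ φ : lang.Sentence, formulaCode φ = n ∧ T₃ ⊨ᵇ φ) ↔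
      (isMem 0 (formulaLevels n n) && isMem [([], none)] (trueEnvs n n)) = true := by
    rw [Bool.and_eq_true, isMem_iff, isMem_iff, mem_formulaLevels_iff (zero_add n).le]
    have h (φ : lang.Sentence) (hφ : formulaCode φ = n) :
        T₃ ⊨ᵇ φ ↔ [([], none)] ∈ trueEnvs n n := by
      subst hφ
      rw [models_T₃_iff, Sentence.Realize, Formula.Realize, ← mem_trueEnvs_iff
        (e := formulaCode φ) (j := 0) φ _ _ (by simp [h0, envs]) (zero_add _).le, h0]
    constructor
    · rintro ⟨φ, hφ, hT⟩
      exact ⟨⟨φ, hφ⟩, (h φ hφ).1 hT⟩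
    · rintro ⟨⟨φ, hφ⟩, hT⟩
      exact ⟨φ, hφ, (h φ hφ).2 hT⟩
  refine ComputablePred.of_eq (p := fun n =>
    (isMem 0 (formulaLevels n n) && isMem [([], none)] (trueEnvs n n)) = true) ?_
    fun n => (key n).symm
  refine ⟨inferInstance, ?_⟩
  simp only [Bool.decide_eq_true]
  exact (Primrec.and.comp
    (primrec_isMem.comp (Primrec.const 0) (primrec_formulaLevels.comp Primrec.id Primrec.id))
    (primrec_isMem.comp (Primrec.const [([], none)])
      (primrec_trueEnvs.comp Primrec.id Primrec.id))).to_comp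

end Correctness

end BoolPresburger


theorem theorem3 :
    BoolPresburger.T₃.IsComplete ∧
    BoolPresburger.IsDecidable BoolPresburger.T₃ ∧
    BoolPresburger.HasQE BoolPresburger.T₃ ∧
    ∀ (I : Type*) [Infinite I], Set I ⊨ BoolPresburger.T₃ :=
  ⟨BoolPresburger.T₃_isComplete, BoolPresburger.T₃_isDecidable, BoolPresburger.T₃_hasQE,
    fun I _ => BoolPresburger.set_model I⟩
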